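/- Let $H$ be a finite-dimensional complex Hilbert space, let $B(H)$ be the algebra of linear operators on $H$ and $B_s(H)$ the real vector space of self-adjoint operators on $H$. Let $|||\cdot|||$ be an arbitrary unitarily invariant norm on $B(H)$, that is, a norm with $|||UAV||| = |||A|||$ for all $A\in B(H)$ and all unitary $U,V$ on $H$. Write $[A,B]=AB-BA$. Suppose that $\phi\colon B_s(H)\to B_s(H)$ is a real-linear map, not necessarily bijective, such that $$|||[\phi(A),\phi(B)]||| = |||[A,B]|||\qquad (A,B\in B_s(H)).$$ Then there exist an operator $U$ on $H$ that is either unitary or antiunitary (a conjugate-linear isometric bijection of $H$) and a real-linear functional $f\colon B_s(H)\to\mathbb{R}$ such that $$\phi(A) = UAU^* + f(A)I\quad\text{for all } A\in B_s(H),$$ or $$\phi(A) = -UAU^* + f(A)I\quad\text{for all } A\in B_s(H).$$ -/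

import Mathlib

/-- A norm `N` on the algebra of bounded operators on `H` (a seminorm that vanishes only at `0`)
is unitarily invariant if `N (U A V) = N A` for all operators `A` and all unitaries `U`, `V`. -/
structure IsUnitarilyInvariantNorm {H : Type*} [NormedAddCommGroup H] [InnerProductSpace ℂ H]
    [CompleteSpace H] (N : Seminorm ℂ (H →L[ℂ] H)) : Prop where
  eq_zero_of_apply_eq_zero : ∀ A : H →L[ℂ] H, N A = 0 → A = 0
  unitary_mul_mul : ∀ U ∈ unitary (H →L[ℂ] H), ∀ V ∈ unitary (H →L[ℂ] H), ∀ A : H →L[ℂ] H,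
    N (U * A * V) = N A

/-- Antiunitary operators on `H`: the bijective conjugate-linear isometries of `H` onto itself. -/
abbrev Antiunitary (H : Type*) [NormedAddCommGroup H] [InnerProductSpace ℂ H] : Type _ :=
  H ≃ₛₗᵢ[starRingEnd ℂ] H

/-- The (complex-linear) operator `U A U*` for an antiunitary operator `U`. The adjoint `U*` of the
conjugate-linear operator `U`, defined by `⟪U* x, y⟫ = ⟪U y, x⟫`, is the inverse of `U`. -/
noncomputable def Antiunitary.conj {H : Type*} [NormedAddCommGroup H] [InnerProductSpace ℂ H]
    (U : Antiunitary H) (A : H →L[ℂ] H) : H →L[ℂ] H :=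
  (U.toContinuousLinearEquiv : H →SL[starRingEnd ℂ] H).comp
    (A.comp (U.symm.toContinuousLinearEquiv : H →SL[starRingEnd ℂ] H))

/-! Scalars are central, so `φ` matters only modulo multiples of the identity. Since the norm is
faithful, `φ` preserves commutativity of self-adjoint operators in both directions. Adding a
multiple of the trace makes `φ` injective, and complexifying then yields a star-preserving linear
bijection `θ` of all operators (`exists_linearEquiv_of_lie`). The goal is to write `θ = c ψ` modulo
scalars, with `c` real and `ψ` a Jordan automorphism.

In dimension at least three, commutativity alone suffices (`exists_jordan_of_three_le`). Operators
of the form `α P + β` with `P` a rank-one projection are recognised by the dimension of their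
commutant, so `θ` permits only such images for rank-one projections. Orthogonal projections have
orthogonal images, the factor `α` is the same for all of them, and fixing the trace removes `β`.
Thus `ψ` sends spectral decompositions to spectral decompositions and preserves squares.

In dimension two commutativity says too little, and the norm itself is used
(`map_sq_of_finrank_eq_two`). In Pauli coordinates the commutator is a cross product and every
unitarily invariant norm is a multiple of Euclidean length. A linear map of real 3-space preserving
lengths of cross products is orthogonal, which is the Jordan property.

The operator algebra is prime, so `ψ` is multiplicative or antimultiplicative
(`map_mul_or_map_mul_rev_of_map_sq`), hence implemented by a unitary or an antiunitary. A single
noncommuting pair then forces `c = 1` or `c = -1`. -/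

open InnerProductSpace Module

/-! ### Jordan homomorphisms onto prime algebras. -/

section JordanHomomorphisms

variable {R S : Type*} [Ring R] [Algebra ℂ R] [Ring S] [Algebra ℂ S]

/-- In a prime complex algebra, `a x b + b x a = 0` for all `x` forces `a = 0` or `b = 0`. -/
lemma eq_zero_or_eq_zero_of_mul_mul_add_mul_mul
    (hS : ∀ a b : S, (∀ x, a * x * b = 0) → a = 0 ∨ b = 0) {a b : S}
    (h : ∀ x, a * x * b + b * x * a = 0) : a = 0 ∨ b = 0 := by
  refine hS a b fun x => ?_
  -- Primeness is used a second time, on `a * x * b` itself. Swapping `a` and `b` in the inner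
  -- factor or in the outer ones turns the same product into opposite values, so it vanishes.
  refine (or_self_iff.mp (hS (a * x * b) (a * x * b) fun y => ?_))
  have h₀ : ∀ z, a * z * b = -(b * z * a) := fun z => eq_neg_of_add_eq_zero_left (h z)
  have e₁ : a * x * b * y * (a * x * b) = -(a * x * a * y * b * x * b) := by
    have := h₀ y
    have h₁ : b * y * a = -(a * y * b) := by rw [this, neg_neg]
    calc a * x * b * y * (a * x * b) = a * x * (b * y * a) * x * b := by noncomm_ring
      _ = _ := by rw [h₁]; noncomm_ring
  have e₂ : a * x * b * y * (a * x * b) = a * x * a * y * b * x * b := by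
    calc a * x * b * y * (a * x * b) = -(b * (x * a * y) * a * x * b) +
          (a * x * b + b * x * a) * y * a * x * b := by noncomm_ring
      _ = a * (x * a * y) * b * x * b := by rw [h, h₀ (x * a * y)]; noncomm_ring
      _ = _ := by noncomm_ring
  have e₃ : (2 : ℂ) • (a * x * b * y * (a * x * b)) = 0 := by
    rw [two_smul]; nth_rw 1 [e₁]; rw [e₂]; simp
  exact (smul_eq_zero_iff_right two_ne_zero).mp e₃

/-- A group is never the union of two proper subgroups. This upgrades an alternative depending on
the element to a uniform one. -/
lemma forall_or_forall_of_forall_or {M : Type*} [AddGroup M] (p q : AddSubgroup M)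
    (h : ∀ x, x ∈ p ∨ x ∈ q) : (∀ x, x ∈ p) ∨ ∀ x, x ∈ q := by
  by_contra! hc
  obtain ⟨⟨x, hx⟩, y, hy⟩ := hc
  have hx' := (h x).resolve_left hx
  have hy' := (h y).resolve_right hy
  rcases h (x + y) with h1 | h1
  · exact hx ((p.add_mem_cancel_right hy').mp h1)
  · exact hy ((q.add_mem_cancel_left hx').mp h1)

variable (ψ : R →ₗ[ℂ] S)

lemma map_mul_add_mul_of_map_sq (hψ : ∀ x, ψ (x * x) = ψ x * ψ x) (x y : R) :
    ψ (x * y) + ψ (y * x) = ψ x * ψ y + ψ y * ψ x := by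
  have h := hψ (x + y)
  have e : (x + y) * (x + y) = x * x + (x * y + y * x) + y * y := by noncomm_ring
  rw [e, map_add, map_add, map_add, map_add, hψ, hψ] at h
  have e' : (ψ x + ψ y) * (ψ x + ψ y) =
    ψ x * ψ x + (ψ x * ψ y + ψ y * ψ x) + ψ y * ψ y := by noncomm_ring
  rw [e'] at h
  exact add_left_cancel (add_right_cancel h)

/-- Taking the Jordan product with `x` twice gives `x²y + yx² + 2xyx`, so the triple product is
expressible through Jordan products. -/
lemma map_mul_mul_of_map_sq (hψ : ∀ x, ψ (x * x) = ψ x * ψ x) (x y : R) :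
    ψ (x * y * x) = ψ x * ψ y * ψ x := by
  have h := map_mul_add_mul_of_map_sq ψ hψ
  have h1 := h x (x * y + y * x)
  have h2 := h (x * x) y
  rw [map_add, h x y] at h1
  have e1 : ψ (x * (x * y + y * x)) + ψ ((x * y + y * x) * x) =
      (ψ (x * x * y) + ψ (y * (x * x))) + (2 : ℂ) • ψ (x * y * x) := by
    rw [← map_add, ← map_add, ← map_smul, ← map_add, two_smul]
    congr 1; noncomm_ring
  rw [e1, h2, hψ] at h1
  have e2 : (2 : ℂ) • ψ (x * y * x) = (2 : ℂ) • (ψ x * ψ y * ψ x) := by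
    rw [two_smul ℂ (ψ x * ψ y * ψ x), eq_sub_of_add_eq' h1]
    noncomm_ring
  exact smul_right_injective S (two_ne_zero (α := ℂ)) e2

/-- A Jordan homomorphism onto a prime complex algebra is multiplicative or
antimultiplicative. -/
theorem map_mul_or_map_mul_rev_of_map_sq
    (hS : ∀ a b : S, (∀ x, a * x * b = 0) → a = 0 ∨ b = 0)
    (hψ : ∀ x, ψ (x * x) = ψ x * ψ x) (hs : Function.Surjective ψ) :
    (∀ x y, ψ (x * y) = ψ x * ψ y) ∨ (∀ x y, ψ (x * y) = ψ y * ψ x) := by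
  have key : ∀ a b, ψ (a * b) = ψ a * ψ b ∨ ψ (a * b) = ψ b * ψ a := by
    intro a b
    have h := map_mul_add_mul_of_map_sq ψ hψ
    have ht := map_mul_mul_of_map_sq ψ hψ
    have h3 : ∀ u v w, ψ (u * v * w) + ψ (w * v * u) = ψ u * ψ v * ψ w + ψ w * ψ v * ψ u := by
      intro u v w
      have h1 := ht (u + w) v
      have e : (u + w) * v * (u + w) = u * v * u + (u * v * w + w * v * u) + w * v * w := by
        noncomm_ring
      rw [e, map_add, map_add, map_add, map_add, ht, ht] at h1
      have e' : (ψ u + ψ w) * ψ v * (ψ u + ψ w) = ψ u * ψ v * ψ u +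
        (ψ u * ψ v * ψ w + ψ w * ψ v * ψ u) + ψ w * ψ v * ψ w := by noncomm_ring
      rw [e'] at h1
      exact add_left_cancel (add_right_cancel h1)
    suffices hz : ∀ x, (ψ (a * b) - ψ a * ψ b) * x * (ψ (a * b) - ψ b * ψ a) +
        (ψ (a * b) - ψ b * ψ a) * x * (ψ (a * b) - ψ a * ψ b) = 0 by
      rcases eq_zero_or_eq_zero_of_mul_mul_add_mul_mul hS hz with h | h
      · exact Or.inl (sub_eq_zero.mp h)
      · exact Or.inr (sub_eq_zero.mp h)
    intro x
    obtain ⟨x, rfl⟩ := hs x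
    -- The element `ab·x·ba + ba·x·ab` is evaluated in two ways: by the linearised triple identity,
    -- and as `a(bxb)a + b(axa)b`. Their difference, with `ψ (b * a)` eliminated, is the required
    -- identity.
    have w1 := h3 (a * b) x (b * a)
    have w2 : ψ (a * b * x * (b * a)) + ψ (b * a * x * (a * b)) =
        ψ a * (ψ b * ψ x * ψ b) * ψ a + ψ b * (ψ a * ψ x * ψ a) * ψ b := by
      rw [← ht, ← ht, ← ht, ← ht]; congr 2 <;> noncomm_ring
    rw [w2, eq_sub_iff_add_eq'.mpr (h a b)] at w1
    rw [← sub_eq_zero] at w1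
    rw [← w1]
    noncomm_ring
  have key2 : ∀ a, (∀ b, ψ (a * b) = ψ a * ψ b) ∨ (∀ b, ψ (a * b) = ψ b * ψ a) := by
    intro a
    exact forall_or_forall_of_forall_or
      { carrier := {b | ψ (a * b) = ψ a * ψ b}
        add_mem' := by intro x y hx hy; simp_all [mul_add]
        zero_mem' := by simp
        neg_mem' := by intro x hx; simp_all }
      { carrier := {b | ψ (a * b) = ψ b * ψ a}
        add_mem' := by intro x y hx hy; simp_all [mul_add, add_mul]
        zero_mem' := by simp
        neg_mem' := by intro x hx; simp_all } (key a)
  exact forall_or_forall_of_forall_or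
    { carrier := {a | ∀ b, ψ (a * b) = ψ a * ψ b}
      add_mem' := by intro x y hx hy; simp_all [add_mul]
      zero_mem' := by simp
      neg_mem' := by intro x hx; simp_all }
    { carrier := {a | ∀ b, ψ (a * b) = ψ b * ψ a}
      add_mem' := by intro x y hx hy; simp_all [mul_add, add_mul]
      zero_mem' := by simp
      neg_mem' := by intro x hx; simp_all } key2

end JordanHomomorphisms

/-! ### Nullity of a diagonal map. -/

section DiagonalMaps

lemma finrank_ker_add_card_of_apply_basis {V κ : Type*} [AddCommGroup V] [Module ℂ V] [Fintype κ]
    (B : Basis κ ℂ V) (f : V →ₗ[ℂ] V) (d : κ → ℂ) (h : ∀ k, f (B k) = d k • B k) :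
    finrank ℂ (LinearMap.ker f) + Fintype.card {k // d k ≠ 0} = Fintype.card κ := by
  classical
  have : Module.Finite ℂ V := Module.Finite.of_basis B
  have hm : LinearMap.toMatrix B B f = Matrix.diagonal d := by
    ext i j
    rw [LinearMap.toMatrix_apply, h, map_smul, Basis.repr_self, Matrix.diagonal_apply]
    by_cases hij : i = j
    · subst hij; simp
    · simp [hij]
  have hr : finrank ℂ (LinearMap.range f) = Fintype.card {k // d k ≠ 0} := by
    rw [← Matrix.rank_diagonal, ← hm, Matrix.rank_eq_finrank_range_toLin _ B B,
      Matrix.toLin_toMatrix]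
  rw [← hr, add_comm, LinearMap.finrank_range_add_finrank_ker, finrank_eq_card_basis B]

end DiagonalMaps

/-! ### Dimension of the commutant of a self-adjoint operator. -/

section Operators

variable {H : Type*} [NormedAddCommGroup H] [InnerProductSpace ℂ H]

/-- The commutator map `X ↦ A X - X A`. -/
noncomputable def commutatorMap (A : H →L[ℂ] H) : (H →L[ℂ] H) →ₗ[ℂ] (H →L[ℂ] H) :=
  LinearMap.mulLeft ℂ A - LinearMap.mulRight ℂ A

lemma mem_ker_commutatorMap {A X : H →L[ℂ] H} :
    X ∈ LinearMap.ker (commutatorMap A) ↔ Commute A X := by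
  simp [commutatorMap, sub_eq_zero, commute_iff_eq]

lemma ContinuousLinearMap.ext_orthonormalBasis {ι : Type*} [Fintype ι]
    (b : OrthonormalBasis ι ℂ H) {A B : H →L[ℂ] H} (h : ∀ i, A (b i) = B (b i)) : A = B := by
  apply ContinuousLinearMap.coe_injective
  exact b.toBasis.ext fun i => by simpa using h i

lemma rankOne_self_apply_basis {ι : Type*} [Fintype ι] [DecidableEq ι]
    (b : OrthonormalBasis ι ℂ H) (i j : ι) :
    rankOne ℂ (b i) (b i) (b j) = if j = i then b j else 0 := by
  rw [rankOne_apply, b.inner_eq_ite]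
  by_cases h : i = j
  · subst h; simp
  · simp [h, Ne.symm h]

variable [FiniteDimensional ℂ H]

/-- The matrix units in an eigenbasis diagonalise the commutator map, with eigenvalues `a i - a k`.
-/
lemma finrank_ker_commutatorMap {ι : Type*} [Fintype ι] [DecidableEq ι]
    (b : OrthonormalBasis ι ℂ H) (A : H →L[ℂ] H) (a : ι → ℂ) (h : ∀ i, A (b i) = a i • b i) :
    finrank ℂ (LinearMap.ker (commutatorMap A)) +
      (Finset.univ.filter fun p : ι × ι => a p.1 ≠ a p.2).card = Fintype.card ι ^ 2 := by
  let B : Basis (ι × ι) ℂ (H →L[ℂ] H) :=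
    (b.toBasis.linearMap b.toBasis).map LinearMap.toContinuousLinearMap
  have hB : ∀ p j, B p (b j) = if p.2 = j then b p.1 else 0 := by
    rintro ⟨i, k⟩ j
    have := Basis.linearMap_apply_apply b.toBasis b.toBasis (i, k) j
    simpa [B] using this
  have := finrank_ker_add_card_of_apply_basis B (commutatorMap A) (fun p => a p.1 - a p.2) (by
    rintro ⟨i, k⟩
    apply ContinuousLinearMap.ext_orthonormalBasis b
    intro j
    change A (B (i, k) (b j)) - B (i, k) (A (b j)) = (a i - a k) • B (i, k) (b j)
    rw [h, map_smul, hB]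
    by_cases hj : k = j
    · subst hj; simp [h, sub_smul]
    · simp [hj])
  rw [Fintype.card_subtype, Fintype.card_prod] at this
  simpa [sub_ne_zero, sq] using this

lemma exists_orthonormalBasis_apply_eq {v : H} (hv : ‖v‖ = 1) (i : Fin (finrank ℂ H)) :
    ∃ b : OrthonormalBasis (Fin (finrank ℂ H)) ℂ H, b i = v := by
  have ho : Orthonormal ℂ (({i} : Set (Fin (finrank ℂ H))).domRestrict fun _ => v) := by
    refine ⟨fun _ => by simpa [Set.domRestrict_apply] using hv, fun x y hxy => ?_⟩
    exact absurd (Subsingleton.elim x y) hxy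
  obtain ⟨b, hb⟩ := ho.exists_orthonormalBasis_extension_of_card_eq (by simp)
  exact ⟨b, hb i rfl⟩

lemma exists_orthonormalBasis_apply_eq_apply_eq {v w : H} (hv : ‖v‖ = 1) (hw : ‖w‖ = 1)
    (hvw : inner ℂ v w = 0) {i j : Fin (finrank ℂ H)} (hij : i ≠ j) :
    ∃ b : OrthonormalBasis (Fin (finrank ℂ H)) ℂ H, b i = v ∧ b j = w := by
  have hwv : inner ℂ w v = 0 := inner_eq_zero_symm.mp hvw
  have hji := hij.symm
  have ho : Orthonormal ℂ (({i, j} : Set (Fin (finrank ℂ H))).domRestrict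
      fun k => if k = i then v else w) := by
    refine ⟨fun x => ?_, ?_⟩
    · simp only [Set.domRestrict_apply]; split_ifs <;> assumption
    · rintro ⟨x, rfl | rfl⟩ ⟨y, rfl | rfl⟩ hxy
      all_goals simp_all [Set.domRestrict_apply]
  obtain ⟨b, hb⟩ := ho.exists_orthonormalBasis_extension_of_card_eq (by simp)
  refine ⟨b, by simpa using hb i (by simp), by simpa [hij.symm] using hb j (by simp)⟩

/-- At most `2 (n - 1)` matrix units fail to commute with the projection: those joining `v` to the
other basis vectors. The bound `2n` is loose enough to state without subtraction, yet still
characterises such operators up to an affine change. -/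
lemma sq_lt_finrank_ker_commutatorMap_rankOne {v : H} (hv : ‖v‖ = 1) :
    finrank ℂ H ^ 2 <
      finrank ℂ (LinearMap.ker (commutatorMap (rankOne ℂ v v))) + 2 * finrank ℂ H := by
  have hn : 0 < finrank ℂ H := by
    have : Nontrivial H := ⟨v, 0, by rintro rfl; simp at hv⟩
    exact finrank_pos
  obtain ⟨b, hb⟩ := exists_orthonormalBasis_apply_eq hv ⟨0, hn⟩
  set k : Fin (finrank ℂ H) := ⟨0, hn⟩
  have h := finrank_ker_commutatorMap b (rankOne ℂ v v) (fun i => if i = k then 1 else 0)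
    (fun i => by rw [← hb, rankOne_self_apply_basis]; split_ifs <;> simp)
  have hc : (Finset.univ.filter fun p : Fin (finrank ℂ H) × Fin (finrank ℂ H) =>
      (if p.1 = k then (1 : ℂ) else 0) ≠ (if p.2 = k then 1 else 0)).card
      ≤ 2 * (finrank ℂ H - 1) := by
    refine (Finset.card_le_card (t := ({k} ×ˢ Finset.univ.erase k) ∪
      (Finset.univ.erase k ×ˢ {k})) ?_).trans ?_
    · rintro ⟨i, j⟩ hp
      simp only [Finset.mem_filter, Finset.mem_union, Finset.mem_product, Finset.mem_singleton,
        Finset.mem_erase, Finset.mem_univ] at hp ⊢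
      by_cases hi : i = k <;> by_cases hj : j = k <;> simp_all
    · refine (Finset.card_union_le _ _).trans ?_
      rw [Finset.card_product, Finset.card_product]
      simp only [Finset.card_singleton, Finset.card_erase_of_mem (Finset.mem_univ k),
        Finset.card_univ, Fintype.card_fin]
      omega
  rw [Fintype.card_fin] at h
  omega

variable [CompleteSpace H]

lemma IsSelfAdjoint.exists_orthonormalBasis {A : H →L[ℂ] H} (hA : IsSelfAdjoint A) :
    ∃ (b : OrthonormalBasis (Fin (finrank ℂ H)) ℂ H) (a : Fin (finrank ℂ H) → ℝ),
      ∀ i, A (b i) = (a i : ℂ) • b i := by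
  have hs : (A : H →ₗ[ℂ] H).IsSymmetric := ContinuousLinearMap.isSelfAdjoint_iff_isSymmetric.mp hA
  exact ⟨hs.eigenvectorBasis rfl, hs.eigenvalues rfl, fun i => hs.apply_eigenvectorBasis rfl i⟩

/-- A self-adjoint operator with a large commutant is a rank-one perturbation of a scalar. -/
lemma IsSelfAdjoint.eq_smul_rankOne_add_of_finrank_ker {A : H →L[ℂ] H} (hA : IsSelfAdjoint A)
    [Nontrivial H]
    (h : finrank ℂ H ^ 2 < finrank ℂ (LinearMap.ker (commutatorMap A)) + 2 * finrank ℂ H) :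
    ∃ (w : H) (α β : ℝ), ‖w‖ = 1 ∧ A = (α : ℂ) • rankOne ℂ w w + (β : ℂ) • 1 := by
  obtain ⟨b, a, hb⟩ := hA.exists_orthonormalBasis
  have hk := finrank_ker_commutatorMap b A (fun i => (a i : ℂ)) hb
  rw [Fintype.card_fin] at hk
  have hc : (Finset.univ.filter fun p : Fin (finrank ℂ H) × Fin (finrank ℂ H) =>
      (a p.1 : ℂ) ≠ (a p.2 : ℂ)).card < 2 * finrank ℂ H := by omega
  have hn : 0 < finrank ℂ H := finrank_pos
  -- Pigeonhole over rows: fewer than `2n` unequal pairs leave some eigenvalue that differs from at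
  -- most one other.
  obtain ⟨i, hi⟩ : ∃ i, (Finset.univ.filter fun j => a i ≠ a j).card ≤ 1 := by
    by_contra! hcon
    apply hc.not_ge
    have : (Finset.univ.filter fun p : Fin (finrank ℂ H) × Fin (finrank ℂ H) =>
        (a p.1 : ℂ) ≠ (a p.2 : ℂ)).card =
        ∑ i, (Finset.univ.filter fun j => a i ≠ a j).card := by
      simp only [ne_eq, Complex.ofReal_inj, Finset.card_filter]
      rw [← Finset.univ_product_univ, Finset.sum_product]
    rw [this]
    calc 2 * finrank ℂ H = ∑ _i : Fin (finrank ℂ H), 2 := by simp [mul_comm]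
      _ ≤ _ := Finset.sum_le_sum fun i _ => hcon i
  obtain ⟨k, hk⟩ : ∃ k, ∀ j, j ≠ k → a j = a i := by
    have : Nonempty (Fin (finrank ℂ H)) := ⟨i⟩
    obtain ⟨k, hk⟩ := Finset.card_le_one_iff_subset_singleton.mp hi
    refine ⟨k, fun j hj => ?_⟩
    by_contra hne
    exact hj (Finset.mem_singleton.mp (hk (by simpa using fun h => hne h.symm)))
  refine ⟨b k, a k - a i, a i, b.norm_eq_one k, ?_⟩
  apply ContinuousLinearMap.ext_orthonormalBasis b
  intro j
  rw [hb]
  simp only [add_apply, smul_apply, rankOne_self_apply_basis, one_apply_eq_self]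
  by_cases hj : j = k
  · subst hj; simp [sub_smul]
  · simp [hj, hk j hj]

end Operators

/-! ### Commutativity preservers in dimension at least three. -/

section CommutativityPreservers

variable {H : Type*} [NormedAddCommGroup H] [InnerProductSpace ℂ H]

/-- Commuting with `rankOne ℂ v v` makes `v` an eigenvector, and an operator for which every vector
is an eigenvector is scalar. -/
lemma exists_smul_one_of_forall_commute_rankOne {A : H →L[ℂ] H}
    (h : ∀ v : H, Commute A (rankOne ℂ v v)) : ∃ z : ℂ, A = z • 1 := by
  obtain ⟨z, hz⟩ := LinearMap.exists_eq_smul_id_of_forall_notLinearIndependent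
    (f := (A : H →ₗ[ℂ] H)) (fun v hli => by
      have hv : v ≠ 0 := hli.ne_zero 0
      have e := DFunLike.congr_fun (h v).eq v
      change A (rankOne ℂ v v v) = rankOne ℂ v v (A v) at e
      rw [rankOne_apply, rankOne_apply, map_smul] at e
      rw [LinearIndependent.pair_iff] at hli
      have := (hli (-inner ℂ v (A v)) (inner ℂ v v) (by
        rw [ContinuousLinearMap.coe_coe, e]; simp)).2
      exact hv (inner_self_eq_zero.mp this))
  exact ⟨z, ContinuousLinearMap.ext fun x => by simpa using LinearMap.congr_fun hz x⟩

lemma inner_eq_zero_or_rankOne_eq_of_commute {v w : H} (hv : ‖v‖ = 1) (hw : ‖w‖ = 1)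
    (h : Commute (rankOne ℂ v v) (rankOne ℂ w w)) :
    inner ℂ v w = 0 ∨ rankOne ℂ v v = rankOne ℂ w w := by
  by_cases h0 : inner ℂ v w = 0
  · exact Or.inl h0
  right
  have e := DFunLike.congr_fun h.eq v
  change rankOne ℂ v v (rankOne ℂ w w v) = rankOne ℂ w w (rankOne ℂ v v v) at e
  have hvv : inner ℂ v v = (1 : ℂ) := by rw [inner_self_eq_norm_sq_to_K, hv]; simp
  have hww : inner ℂ w w = (1 : ℂ) := by rw [inner_self_eq_norm_sq_to_K, hw]; simp
  simp only [rankOne_apply, map_smul, hvv, one_smul] at e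
  have hwv : inner ℂ w v ≠ (0 : ℂ) := fun h => h0 (inner_eq_zero_symm.mp h)
  -- Nonorthogonal unit vectors with commuting projections are proportional; the factor is
  -- unimodular and cancels in the projection.
  have e' : inner ℂ v w • v = w := smul_right_injective H hwv e
  set z : ℂ := inner ℂ v w with hz
  have hzz : (starRingEnd ℂ) z * z = 1 := by
    rw [← e', inner_smul_left, inner_smul_right, hvv, mul_one] at hww
    exact hww
  rw [← e']
  ext x
  simp only [rankOne_apply, inner_smul_left, smul_smul]
  rw [mul_right_comm, hzz, one_mul]

lemma isSelfAdjoint_rankOne [CompleteSpace H] (v : H) : IsSelfAdjoint (rankOne ℂ v v) := by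
  rw [ContinuousLinearMap.isSelfAdjoint_iff', adjoint_rankOne]

lemma exists_smul_one_of_forall_isSelfAdjoint_commute [CompleteSpace H] {A : H →L[ℂ] H}
    (h : ∀ X, IsSelfAdjoint X → Commute X A) : ∃ z : ℂ, A = z • 1 :=
  exists_smul_one_of_forall_commute_rankOne fun v => (h _ (isSelfAdjoint_rankOne v)).symm

lemma exists_smul_one_of_apply_eq_smul_one [CompleteSpace H] {θ : (H →L[ℂ] H) ≃ₗ[ℂ] (H →L[ℂ] H)}
    (hcomm : ∀ A X, IsSelfAdjoint A → (Commute A X ↔ Commute (θ A) (θ X)))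
    {A : H →L[ℂ] H} {z : ℂ} (h : θ A = z • 1) : ∃ z : ℂ, A = z • 1 :=
  exists_smul_one_of_forall_isSelfAdjoint_commute fun X hX => (hcomm X A hX).mpr (by
    rw [h]; exact (Commute.one_right _).smul_right z)

lemma exists_apply_one_eq_smul_one [CompleteSpace H] {θ : (H →L[ℂ] H) ≃ₗ[ℂ] (H →L[ℂ] H)}
    (hcomm : ∀ A X, IsSelfAdjoint A → (Commute A X ↔ Commute (θ A) (θ X))) :
    ∃ z : ℂ, θ 1 = z • 1 := by
  refine exists_smul_one_of_forall_commute_rankOne fun v => ?_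
  obtain ⟨X, hX⟩ := θ.surjective (rankOne ℂ v v)
  rw [← hX]
  exact (hcomm 1 X (IsSelfAdjoint.one _)).mp (Commute.one_left _)

lemma Orthonormal.sum_smul_rankOne_apply {ι : Type*} [Fintype ι] {u : ι → H}
    (hu : Orthonormal ℂ u) (a : ι → ℂ) (i : ι) :
    (∑ j, a j • rankOne ℂ (u j) (u j)) (u i) = a i • u i := by
  classical
  simp [orthonormal_iff_ite.mp hu]

lemma Orthonormal.sum_smul_rankOne_mul_self {ι : Type*} [Fintype ι] {u : ι → H}
    (hu : Orthonormal ℂ u) (a : ι → ℂ) :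
    (∑ j, a j • rankOne ℂ (u j) (u j)) * (∑ j, a j • rankOne ℂ (u j) (u j)) =
      ∑ j, (a j * a j) • rankOne ℂ (u j) (u j) := by
  rw [Finset.mul_sum]
  refine Finset.sum_congr rfl fun i _ => ?_
  ext x
  change (∑ j, a j • rankOne ℂ (u j) (u j)) (a i • rankOne ℂ (u i) (u i) x) = _
  rw [rankOne_apply, map_smul, map_smul, hu.sum_smul_rankOne_apply]
  simp [smul_smul, mul_assoc, mul_comm]

/-- A complex-linear map that preserves squares of self-adjoint operators preserves all squares. -/
lemma map_sq_of_forall_isSelfAdjoint [CompleteSpace H] (ψ : (H →L[ℂ] H) →ₗ[ℂ] (H →L[ℂ] H))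
    (h : ∀ A, IsSelfAdjoint A → ψ (A * A) = ψ A * ψ A) (A : H →L[ℂ] H) :
    ψ (A * A) = ψ A * ψ A := by
  set X : H →L[ℂ] H := (realPart A : H →L[ℂ] H) with hX
  set Y : H →L[ℂ] H := (imaginaryPart A : H →L[ℂ] H) with hY
  have hXs : IsSelfAdjoint X := (realPart A).2
  have hYs : IsSelfAdjoint Y := (imaginaryPart A).2
  have hA : A = X + Complex.I • Y := (realPart_add_I_smul_imaginaryPart A).symm
  have hXY := h (X + Y) (hXs.add hYs)
  have e : (X + Y) * (X + Y) = X * X + (X * Y + Y * X) + Y * Y := by noncomm_ring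
  rw [e, map_add, map_add, map_add ψ X, h X hXs, h Y hYs] at hXY
  have e' : (ψ X + ψ Y) * (ψ X + ψ Y) = ψ X * ψ X + (ψ X * ψ Y + ψ Y * ψ X) + ψ Y * ψ Y := by
    noncomm_ring
  rw [e'] at hXY
  have hXY' := add_left_cancel (add_right_cancel hXY)
  have q : ∀ U V : H →L[ℂ] H, (U + Complex.I • V) * (U + Complex.I • V) =
      U * U + Complex.I • (U * V + V * U) - V * V := by
    intro U V
    rw [add_mul, mul_add, mul_add, smul_mul_assoc, smul_mul_assoc, mul_smul_comm, mul_smul_comm,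
      smul_smul, Complex.I_mul_I, smul_add]
    module
  rw [hA, q, map_sub, map_add, map_smul, hXY', h X hXs, h Y hYs, map_add ψ X, map_smul, q]

/-- The map `θ` carries the commutant of `A` onto that of `θ A`. This is why `hcomm` allows
arbitrary `X` and asks only `A` to be self-adjoint. -/
lemma finrank_ker_commutatorMap_apply [CompleteSpace H] {θ : (H →L[ℂ] H) ≃ₗ[ℂ] (H →L[ℂ] H)}
    (hcomm : ∀ A X, IsSelfAdjoint A → (Commute A X ↔ Commute (θ A) (θ X)))
    {A : H →L[ℂ] H} (hA : IsSelfAdjoint A) :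
    finrank ℂ (LinearMap.ker (commutatorMap (θ A))) =
      finrank ℂ (LinearMap.ker (commutatorMap A)) := by
  have : LinearMap.ker (commutatorMap (θ A)) =
      (LinearMap.ker (commutatorMap A)).map (θ : (H →L[ℂ] H) →ₗ[ℂ] (H →L[ℂ] H)) := by
    ext X
    obtain ⟨X, rfl⟩ := θ.surjective X
    rw [mem_ker_commutatorMap, ← hcomm A _ hA, ← mem_ker_commutatorMap]
    simp
  rw [this, LinearEquiv.finrank_map_eq]

variable [FiniteDimensional ℂ H]

lemma smul_one_eq_zero_of_trace_eq_zero {z : ℂ}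
    (h : LinearMap.trace ℂ H ((z • 1 : H →L[ℂ] H) : H →ₗ[ℂ] H) = 0) :
    (z • 1 : H →L[ℂ] H) = 0 := by
  have e : ((z • 1 : H →L[ℂ] H) : H →ₗ[ℂ] H) = z • LinearMap.id := rfl
  rw [e, map_smul, LinearMap.trace_id, smul_eq_mul, mul_eq_zero, Nat.cast_eq_zero] at h
  rcases h with rfl | h
  · simp
  · have := finrank_zero_iff.mp h
    exact Subsingleton.elim _ _

lemma trace_star [CompleteSpace H] (A : H →L[ℂ] H) :
    LinearMap.trace ℂ H (star A : H →L[ℂ] H) = star (LinearMap.trace ℂ H A) := by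
  rw [LinearMap.trace_eq_sum_inner _ (stdOrthonormalBasis ℂ H),
    LinearMap.trace_eq_sum_inner _ (stdOrthonormalBasis ℂ H), star_sum]
  refine Finset.sum_congr rfl fun i _ => ?_
  simp [ContinuousLinearMap.star_eq_adjoint, ContinuousLinearMap.adjoint_inner_right]

/-- Subtracting scalars, a linear map can be normalized to preserve the trace. -/
lemma exists_trace_preserving [Nontrivial H] (θ : (H →L[ℂ] H) →ₗ[ℂ] (H →L[ℂ] H)) {c : ℝ}
    (hc : c ≠ 0) : ∃ ψ : (H →L[ℂ] H) →ₗ[ℂ] (H →L[ℂ] H),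
      (∀ A, ∃ z : ℂ, θ A = (c : ℂ) • ψ A + z • 1) ∧
      ∀ A, LinearMap.trace ℂ H (ψ A : H →L[ℂ] H) = LinearMap.trace ℂ H (A : H →L[ℂ] H) := by
  let T : (H →L[ℂ] H) →ₗ[ℂ] ℂ :=
    LinearMap.trace ℂ H ∘ₗ (LinearMap.toContinuousLinearMap (E := H) (F' := H)).symm.toLinearMap
  have hT : ∀ A, T A = LinearMap.trace ℂ H (A : H →L[ℂ] H) := fun _ => rfl
  have hc' : (c : ℂ) ≠ 0 := by exact_mod_cast hc
  have hn : (finrank ℂ H : ℂ) ≠ 0 := by exact_mod_cast (finrank_pos (R := ℂ) (M := H)).ne'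
  have hT1 : T 1 = finrank ℂ H := (LinearMap.trace_id ℂ H :)
  let β : (H →L[ℂ] H) →ₗ[ℂ] ℂ := (finrank ℂ H : ℂ)⁻¹ • (T ∘ₗ θ - (c : ℂ) • T)
  refine ⟨(c : ℂ)⁻¹ • (θ - β.smulRight 1), fun A => ⟨β A, ?_⟩, fun A => ?_⟩
  · simp [smul_smul, hc']
  · rw [← hT, ← hT]
    simp only [LinearMap.smul_apply, LinearMap.sub_apply, LinearMap.smulRight_apply, map_smul,
      map_sub, hT1, β, LinearMap.comp_apply, smul_eq_mul]
    field_simp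
    ring

variable [CompleteSpace H]

/-! ### Images of rank-one projections. -/

section Preserver

variable {θ : (H →L[ℂ] H) ≃ₗ[ℂ] (H →L[ℂ] H)}

lemma exists_apply_rankOne_eq [Nontrivial H] (hstar : ∀ X, θ (star X) = star (θ X))
    (hcomm : ∀ A X, IsSelfAdjoint A → (Commute A X ↔ Commute (θ A) (θ X)))
    {v : H} (hv : ‖v‖ = 1) :
    ∃ (w : H) (α β : ℝ), ‖w‖ = 1 ∧
      θ (rankOne ℂ v v) = (α : ℂ) • rankOne ℂ w w + (β : ℂ) • 1 := by
  have hP := isSelfAdjoint_rankOne v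
  have hθ : IsSelfAdjoint (θ (rankOne ℂ v v)) := by
    rw [IsSelfAdjoint, ← hstar, hP.star_eq]
  refine hθ.eq_smul_rankOne_add_of_finrank_ker ?_
  rw [finrank_ker_commutatorMap_apply hcomm hP]
  exact sq_lt_finrank_ker_commutatorMap_rankOne hv

/-- Only scalars have scalar images, and a rank-one projection is not scalar in dimension two or
more. -/
lemma coefficient_ne_zero (hn : 2 ≤ finrank ℂ H)
    (hcomm : ∀ A X, IsSelfAdjoint A → (Commute A X ↔ Commute (θ A) (θ X)))
    {v : H} (hv : ‖v‖ = 1) {w : H} {α β : ℂ}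
    (h : θ (rankOne ℂ v v) = α • rankOne ℂ w w + β • 1) : α ≠ 0 := by
  rintro rfl
  rw [zero_smul, zero_add] at h
  obtain ⟨z, hz⟩ := exists_smul_one_of_apply_eq_smul_one hcomm h
  obtain ⟨b, hb⟩ := exists_orthonormalBasis_apply_eq hv ⟨0, by omega⟩
  have h0 := DFunLike.congr_fun hz (b ⟨0, by omega⟩)
  have h1 := DFunLike.congr_fun hz (b ⟨1, by omega⟩)
  rw [← hb, rankOne_self_apply_basis] at h0 h1
  have e0 := b.toBasis.ne_zero ⟨0, by omega⟩
  have e1 := b.toBasis.ne_zero ⟨1, by omega⟩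
  simp only [b.coe_toBasis] at e0 e1
  simp only [smul_apply, one_apply_eq_self, Fin.mk.injEq, one_ne_zero, if_false] at h1
  have hz0 : z = 0 := by simpa [e1] using h1.symm
  simp [hz0, e0] at h0

lemma inner_eq_zero_of_apply_rankOne (hn : 3 ≤ finrank ℂ H)
    (hcomm : ∀ A X, IsSelfAdjoint A → (Commute A X ↔ Commute (θ A) (θ X)))
    (b : OrthonormalBasis (Fin (finrank ℂ H)) ℂ H) {i j : Fin (finrank ℂ H)} (hij : i ≠ j)
    {w w' : H} {α α' β β' : ℂ} (hw : ‖w‖ = 1) (hw' : ‖w'‖ = 1)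
    (h : θ (rankOne ℂ (b i) (b i)) = α • rankOne ℂ w w + β • 1)
    (h' : θ (rankOne ℂ (b j) (b j)) = α' • rankOne ℂ w' w' + β' • 1) :
    inner ℂ w w' = 0 := by
  have hα : α ≠ 0 := coefficient_ne_zero (by omega) hcomm (b.norm_eq_one i) h
  have hα' : α' ≠ 0 := coefficient_ne_zero (by omega) hcomm (b.norm_eq_one j) h'
  have hc : Commute (rankOne ℂ (b i) (b i)) (rankOne ℂ (b j) (b j)) := by
    apply ContinuousLinearMap.ext_orthonormalBasis b
    intro k
    change rankOne ℂ (b i) (b i) (rankOne ℂ (b j) (b j) (b k)) =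
      rankOne ℂ (b j) (b j) (rankOne ℂ (b i) (b i) (b k))
    rw [rankOne_self_apply_basis, rankOne_self_apply_basis]
    by_cases hi : k = i <;> by_cases hj : k = j
    · exact absurd (hi.symm.trans hj) hij
    · rw [if_neg hj, if_pos hi, map_zero, rankOne_self_apply_basis, if_neg hj]
    · rw [if_pos hj, if_neg hi, map_zero, rankOne_self_apply_basis, if_neg hi]
    · rw [if_neg hj, if_neg hi, map_zero, map_zero]
  have hc' := (hcomm _ _ (isSelfAdjoint_rankOne _)).mp hc
  have hw1 : rankOne ℂ w w = α⁻¹ • (θ (rankOne ℂ (b i) (b i)) - β • 1) := by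
    rw [h]; simp [smul_smul, hα]
  have hw2 : rankOne ℂ w' w' = α'⁻¹ • (θ (rankOne ℂ (b j) (b j)) - β' • 1) := by
    rw [h']; simp [smul_smul, hα']
  have hcw : Commute (rankOne ℂ w w) (rankOne ℂ w' w') := by
    rw [hw1, hw2]
    refine Commute.smul_left (Commute.smul_right ?_ _) _
    refine Commute.sub_left (Commute.sub_right hc' ?_) ?_
    · exact (Commute.one_right _).smul_right _
    · exact (Commute.one_left _).smul_left _
  refine (inner_eq_zero_or_rankOne_eq_of_commute hw hw' hcw).resolve_right fun he => ?_
  -- If both images involved the same projection, this combination would have a scalar image and so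
  -- be scalar. A third basis vector forces that scalar to be zero, contradicting `α' ≠ 0`. In
  -- dimension two the identity is itself such a combination, so the argument fails there.
  have hs : θ (α' • rankOne ℂ (b i) (b i) - α • rankOne ℂ (b j) (b j)) =
      (α' * β - α * β') • 1 := by
    rw [map_sub, map_smul, map_smul, h, h', he]
    module
  obtain ⟨z, hz⟩ := exists_smul_one_of_apply_eq_smul_one hcomm hs
  obtain ⟨k, hki, hkj⟩ : ∃ k, k ≠ i ∧ k ≠ j := by
    obtain ⟨k, hk⟩ := Finset.exists_mem_notMem_of_card_lt_card (s := {i, j})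
      (t := (Finset.univ : Finset (Fin (finrank ℂ H)))) (by
        rw [Finset.card_pair hij, Finset.card_univ, Fintype.card_fin]; omega)
    refine ⟨k, ?_⟩
    simpa using hk.2
  have ek := DFunLike.congr_fun hz (b k)
  have ei := DFunLike.congr_fun hz (b i)
  have nk := b.toBasis.ne_zero k
  have ni := b.toBasis.ne_zero i
  simp only [b.coe_toBasis] at nk ni
  simp only [sub_apply, smul_apply, rankOne_self_apply_basis, one_apply_eq_self, if_neg hki,
    if_neg hkj, smul_zero, sub_zero, if_true, if_neg hij] at ek ei
  have hz0 : z = 0 := by simpa [nk] using ek.symm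
  simp [hz0, ni, hα'] at ei

/-- A choice of vectors and scalars describing the images of rank-one projections. -/
structure RankOneImages (θ : (H →L[ℂ] H) ≃ₗ[ℂ] (H →L[ℂ] H)) (w : H → H) (α β : H → ℝ) : Prop where
  norm_eq_one : ∀ v, ‖v‖ = 1 → ‖w v‖ = 1
  apply_rankOne : ∀ v, ‖v‖ = 1 →
    θ (rankOne ℂ v v) = (α v : ℂ) • rankOne ℂ (w v) (w v) + (β v : ℂ) • 1

variable {w : H → H} {α β : H → ℝ}

lemma RankOneImages.orthonormal (hw : RankOneImages θ w α β) (hn : 3 ≤ finrank ℂ H)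
    (hcomm : ∀ A X, IsSelfAdjoint A → (Commute A X ↔ Commute (θ A) (θ X)))
    (b : OrthonormalBasis (Fin (finrank ℂ H)) ℂ H) : Orthonormal ℂ fun i => w (b i) :=
  ⟨fun i => hw.norm_eq_one _ (b.norm_eq_one i), fun i j hij =>
    inner_eq_zero_of_apply_rankOne hn hcomm b hij (hw.norm_eq_one _ (b.norm_eq_one i))
      (hw.norm_eq_one _ (b.norm_eq_one j)) (hw.apply_rankOne _ (b.norm_eq_one i))
      (hw.apply_rankOne _ (b.norm_eq_one j))⟩

lemma RankOneImages.coefficient_eq (hw : RankOneImages θ w α β) (hn : 3 ≤ finrank ℂ H)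
    (hcomm : ∀ A X, IsSelfAdjoint A → (Commute A X ↔ Commute (θ A) (θ X)))
    (b : OrthonormalBasis (Fin (finrank ℂ H)) ℂ H) (i j : Fin (finrank ℂ H)) :
    α (b i) = α (b j) := by
  have ho := hw.orthonormal hn hcomm b
  obtain ⟨s, hs⟩ := exists_apply_one_eq_smul_one hcomm
  have hsum : θ 1 = (∑ k, (α (b k) : ℂ) • rankOne ℂ (w (b k)) (w (b k))) +
      (∑ k, (β (b k) : ℂ)) • 1 := by
    have h1 : (1 : H →L[ℂ] H) = ∑ k, rankOne ℂ (b k) (b k) := b.sum_rankOne_eq_id.symm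
    rw [h1, map_sum, Finset.sum_congr rfl fun k _ => hw.apply_rankOne _ (b.norm_eq_one k),
      Finset.sum_add_distrib, Finset.sum_smul, ← h1]
  -- Both expressions for `θ 1` are compared at the common eigenvector `w (b k)`; the right-hand
  -- side does not depend on `k`.
  have key : ∀ k, (α (b k) : ℂ) = s - ∑ k, (β (b k) : ℂ) := by
    intro k
    have e := DFunLike.congr_fun (hs.symm.trans hsum) (w (b k))
    rw [add_apply, ho.sum_smul_rankOne_apply, smul_apply, smul_apply, one_apply_eq_self,
      ← add_smul] at e
    have := smul_left_injective ℂ (ho.ne_zero k) e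
    rw [this]; ring
  exact_mod_cast (key i).trans (key j).symm

lemma RankOneImages.coefficient_const (hw : RankOneImages θ w α β) (hn : 3 ≤ finrank ℂ H)
    (hcomm : ∀ A X, IsSelfAdjoint A → (Commute A X ↔ Commute (θ A) (θ X)))
    {v v' : H} (hv : ‖v‖ = 1) (hv' : ‖v'‖ = 1) : α v = α v' := by
  -- In dimension three a vector orthogonal to both exists, and it links `v` to `v'` through two
  -- orthonormal bases.
  obtain ⟨u, hu, hu0⟩ : ∃ u ∈ (Submodule.span ℂ {v, v'})ᗮ, u ≠ 0 := by
    refine Submodule.exists_mem_ne_zero_of_ne_bot fun hbot => ?_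
    have h1 := (Submodule.span ℂ {v, v'}).finrank_add_finrank_orthogonal
    have h2 : finrank ℂ (Submodule.span ℂ {v, v'}) ≤ 2 := by
      classical
      have := finrank_span_finset_le_card (R := ℂ) ({v, v'} : Finset H)
      simp only [Finset.coe_insert, Finset.coe_singleton] at this
      exact this.trans Finset.card_le_two
    rw [hbot, finrank_bot] at h1
    omega
  have hn0 : ‖u‖ ≠ 0 := norm_ne_zero_iff.mpr hu0
  set x : H := ((‖u‖⁻¹ : ℝ) : ℂ) • u with hx
  have hx1 : ‖x‖ = 1 := by
    rw [hx, norm_smul, Complex.norm_real, norm_inv, norm_norm, inv_mul_cancel₀ hn0]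
  have hxm : x ∈ (Submodule.span ℂ {v, v'})ᗮ := Submodule.smul_mem _ _ hu
  rw [Submodule.mem_orthogonal] at hxm
  have aux : ∀ y, ‖y‖ = 1 → inner ℂ y x = 0 → α y = α x := by
    intro y hy hyx
    obtain ⟨b, h0, h1⟩ := exists_orthonormalBasis_apply_eq_apply_eq hy hx1 hyx
      (i := ⟨0, by omega⟩) (j := ⟨1, by omega⟩) (by simp)
    rw [← h0, ← h1]
    exact hw.coefficient_eq hn hcomm b _ _
  rw [aux v hv (hxm v (Submodule.subset_span (by simp))),
    aux v' hv' (hxm v' (Submodule.subset_span (by simp)))]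

end Preserver

lemma IsSelfAdjoint.exists_eq_sum_rankOne {A : H →L[ℂ] H} (hA : IsSelfAdjoint A) :
    ∃ (b : OrthonormalBasis (Fin (finrank ℂ H)) ℂ H) (a : Fin (finrank ℂ H) → ℝ),
      A = ∑ i, (a i : ℂ) • rankOne ℂ (b i) (b i) := by
  obtain ⟨b, a, h⟩ := hA.exists_orthonormalBasis
  refine ⟨b, a, ContinuousLinearMap.ext_orthonormalBasis b fun i => ?_⟩
  rw [h, b.orthonormal.sum_smul_rankOne_apply]

/-- In dimension at least three, a star-preserving linear bijection preserving commutativity with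
self-adjoint operators in both directions is, up to a real factor and modulo scalars, a
trace-preserving Jordan homomorphism. -/
theorem exists_jordan_of_three_le (hn : 3 ≤ finrank ℂ H) (θ : (H →L[ℂ] H) ≃ₗ[ℂ] (H →L[ℂ] H))
    (hstar : ∀ X, θ (star X) = star (θ X))
    (hcomm : ∀ A X, IsSelfAdjoint A → (Commute A X ↔ Commute (θ A) (θ X))) :
    ∃ (c : ℝ) (ψ : (H →L[ℂ] H) →ₗ[ℂ] (H →L[ℂ] H)), c ≠ 0 ∧
      (∀ A, ∃ z : ℂ, θ A = (c : ℂ) • ψ A + z • 1) ∧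
      (∀ A, LinearMap.trace ℂ H (ψ A : H →L[ℂ] H) = LinearMap.trace ℂ H (A : H →L[ℂ] H)) ∧
      ∀ A, ψ (A * A) = ψ A * ψ A := by
  have : Nontrivial H := nontrivial_of_finrank_pos (R := ℂ) (by omega)
  obtain ⟨w, α, β, hw⟩ : ∃ w α β, RankOneImages θ w α β := by
    have h : ∀ v : H, ∃ (w : H) (α β : ℝ), ‖v‖ = 1 → (‖w‖ = 1 ∧
      θ (rankOne ℂ v v) = (α : ℂ) • rankOne ℂ w w + (β : ℂ) • 1) := by
      intro v
      by_cases hv : ‖v‖ = 1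
      · obtain ⟨w, α, β, h⟩ := exists_apply_rankOne_eq hstar hcomm hv
        exact ⟨w, α, β, fun _ => h⟩
      · exact ⟨0, 0, 0, fun h => absurd h hv⟩
    choose w α β h using h
    exact ⟨w, α, β, fun v hv => (h v hv).1, fun v hv => (h v hv).2⟩
  obtain ⟨v₀, hv₀⟩ : ∃ v₀ : H, ‖v₀‖ = 1 := exists_norm_eq H zero_le_one
  have hc : (α v₀ : ℂ) ≠ 0 :=
    coefficient_ne_zero (by omega) hcomm hv₀ (hw.apply_rankOne v₀ hv₀)
  obtain ⟨ψ, hψ, htr⟩ := exists_trace_preserving (θ : (H →L[ℂ] H) →ₗ[ℂ] (H →L[ℂ] H))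
    (c := α v₀) (by exact_mod_cast hc)
  refine ⟨α v₀, ψ, by exact_mod_cast hc, hψ, htr, map_sq_of_forall_isSelfAdjoint ψ fun A hA => ?_⟩
  -- The two sides differ by a scalar and both have trace one.
  have hP : ∀ v, ‖v‖ = 1 → ψ (rankOne ℂ v v) = rankOne ℂ (w v) (w v) := by
    intro v hv
    obtain ⟨z, hz⟩ := hψ (rankOne ℂ v v)
    rw [LinearEquiv.coe_coe, hw.apply_rankOne v hv, hw.coefficient_const hn hcomm hv hv₀] at hz
    have e : ψ (rankOne ℂ v v) - rankOne ℂ (w v) (w v) = ((α v₀ : ℂ)⁻¹ * (β v - z)) • 1 := by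
      rw [mul_smul, eq_inv_smul_iff₀ hc, smul_sub, sub_smul, sub_eq_sub_iff_add_eq_add, ← hz]
      abel
    have ht : LinearMap.trace ℂ H
        ((ψ (rankOne ℂ v v) - rankOne ℂ (w v) (w v) : H →L[ℂ] H) : H →ₗ[ℂ] H) = 0 := by
      rw [ContinuousLinearMap.toLinearMap_sub, map_sub, htr, trace_rankOne, trace_rankOne,
        inner_self_eq_norm_sq_to_K, inner_self_eq_norm_sq_to_K, hv, hw.norm_eq_one v hv, sub_self]
    rw [e] at ht
    rw [smul_one_eq_zero_of_trace_eq_zero ht] at e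
    exact sub_eq_zero.mp e
  obtain ⟨b, a, hAb⟩ := hA.exists_eq_sum_rankOne
  have hm : ∀ a : Fin (finrank ℂ H) → ℂ, ψ (∑ i, a i • rankOne ℂ (b i) (b i)) =
      ∑ i, a i • rankOne ℂ (w (b i)) (w (b i)) := by
    intro a
    rw [map_sum]
    exact Finset.sum_congr rfl fun i _ => by rw [map_smul, hP _ (b.norm_eq_one i)]
  rw [hAb, b.orthonormal.sum_smul_rankOne_mul_self, hm, hm,
    (hw.orthonormal hn hcomm b).sum_smul_rankOne_mul_self]

end CommutativityPreservers

/-! ### Dimension two: Pauli coordinates and cross products. -/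

section Pauli

open Matrix

variable {H : Type*} [NormedAddCommGroup H] [InnerProductSpace ℂ H]

lemma dotProduct_self_nonneg {ι : Type*} [Fintype ι] (x : ι → ℝ) : 0 ≤ x ⬝ᵥ x :=
  Finset.sum_nonneg fun i _ => mul_self_nonneg (x i)

/-- A `3 × 3` real positive semidefinite Gram matrix whose cofactor matrix is the identity is the
identity. -/
lemma dotProduct_eq_of_cross {u v w : Fin 3 → ℝ}
    (huv : u ⨯₃ v ⬝ᵥ u ⨯₃ v = 1) (huw : u ⨯₃ w ⬝ᵥ u ⨯₃ w = 1) (hvw : v ⨯₃ w ⬝ᵥ v ⨯₃ w = 1)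
    (h1 : u ⨯₃ v ⬝ᵥ u ⨯₃ w = 0) (h2 : v ⨯₃ u ⬝ᵥ v ⨯₃ w = 0) (h3 : w ⨯₃ u ⬝ᵥ w ⨯₃ v = 0) :
    u ⬝ᵥ u = 1 ∧ v ⬝ᵥ v = 1 ∧ w ⬝ᵥ w = 1 ∧ u ⬝ᵥ v = 0 ∧ u ⬝ᵥ w = 0 ∧ v ⬝ᵥ w = 0 := by
  rw [cross_dot_cross] at *
  have pu : 0 ≤ u ⬝ᵥ u := dotProduct_self_nonneg u
  have pv : 0 ≤ v ⬝ᵥ v := dotProduct_self_nonneg v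
  have pw : 0 ≤ w ⬝ᵥ w := dotProduct_self_nonneg w
  simp only [dotProduct_comm v u, dotProduct_comm w u, dotProduct_comm w v] at *
  generalize u ⬝ᵥ u = a at *
  generalize v ⬝ᵥ v = d at *
  generalize w ⬝ᵥ w = f at *
  generalize u ⬝ᵥ v = b at *
  generalize u ⬝ᵥ w = c at *
  generalize v ⬝ᵥ w = e at *
  -- For a Gram matrix `G` whose cofactor matrix is the identity, the cofactor identity reads `G =
  -- det G • 1`, which kills the off-diagonal entries. Nonnegativity of the diagonal then excludes
  -- `G = -1`.
  have hb : b = 0 := by linear_combination (-b) * huw + a * h3 + c * h1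
  have hc : c = 0 := by linear_combination (-c) * huv + a * h2 + b * h1
  have he : e = 0 := by linear_combination (-e) * huv + d * h1 + b * h2
  subst hb hc he
  have e1 : a * d = 1 := by linear_combination huv
  have e2 : a * f = 1 := by linear_combination huw
  have e3 : d * f = 1 := by linear_combination hvw
  have ea : a * a = 1 := by linear_combination (a * f) * e1 + e2 - (a * a) * e3
  have a1 : a = 1 := by nlinarith
  subst a1
  exact ⟨rfl, by linarith, by linarith, rfl, rfl, rfl⟩

/-- The Pauli operators of an orthonormal basis of a two-dimensional space. -/
noncomputable def pauli (b : OrthonormalBasis (Fin 2) ℂ H) : Fin 3 → H →L[ℂ] H :=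
  ![rankOne ℂ (b 0) (b 1) + rankOne ℂ (b 1) (b 0),
    Complex.I • (rankOne ℂ (b 1) (b 0) - rankOne ℂ (b 0) (b 1)),
    rankOne ℂ (b 0) (b 0) - rankOne ℂ (b 1) (b 1)]

/-- The real combination of the Pauli operators with given coordinates. -/
noncomputable def pauliSum (b : OrthonormalBasis (Fin 2) ℂ H) (x : Fin 3 → ℝ) : H →L[ℂ] H :=
  (x 0 : ℂ) • pauli b 0 + (x 1 : ℂ) • pauli b 1 + (x 2 : ℂ) • pauli b 2

variable (b : OrthonormalBasis (Fin 2) ℂ H)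

lemma pauliSum_apply_zero (x : Fin 3 → ℝ) :
    pauliSum b x (b 0) = (x 2 : ℂ) • b 0 + (x 0 + x 1 * Complex.I : ℂ) • b 1 := by
  simp [pauliSum, pauli, b.inner_eq_ite]
  module

lemma pauliSum_apply_one (x : Fin 3 → ℝ) :
    pauliSum b x (b 1) = (x 0 - x 1 * Complex.I : ℂ) • b 0 - (x 2 : ℂ) • b 1 := by
  simp [pauliSum, pauli, b.inner_eq_ite]
  module

lemma ext_orthonormalBasis_two {A B : H →L[ℂ] H} (h0 : A (b 0) = B (b 0))
    (h1 : A (b 1) = B (b 1)) : A = B :=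
  ContinuousLinearMap.ext_orthonormalBasis b fun i => by fin_cases i <;> assumption

lemma pauliSum_mul (x y : Fin 3 → ℝ) :
    pauliSum b x * pauliSum b y =
      ((x ⬝ᵥ y : ℝ) : ℂ) • 1 + Complex.I • pauliSum b (x ⨯₃ y) := by
  apply ext_orthonormalBasis_two b
  · change pauliSum b x (pauliSum b y (b 0)) = _
    simp only [pauliSum_apply_zero, pauliSum_apply_one, map_add, map_smul, _root_.add_apply,
      _root_.smul_apply, one_apply_eq_self, cross_apply, vec3_dotProduct]
    match_scalars <;> simp <;> ring_nf <;> simp only [Complex.I_sq] <;> ring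
  · change pauliSum b x (pauliSum b y (b 1)) = _
    simp only [pauliSum_apply_zero, pauliSum_apply_one, map_sub, map_smul, _root_.add_apply,
      _root_.smul_apply, one_apply_eq_self, cross_apply, vec3_dotProduct]
    match_scalars <;> simp <;> ring_nf <;> simp only [Complex.I_sq] <;> ring

lemma pauliSum_add (x y : Fin 3 → ℝ) : pauliSum b (x + y) = pauliSum b x + pauliSum b y := by
  simp only [pauliSum, Pi.add_apply, Complex.ofReal_add]; module

lemma pauliSum_smul (r : ℝ) (x : Fin 3 → ℝ) : pauliSum b (r • x) = (r : ℂ) • pauliSum b x := by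
  simp only [pauliSum, Pi.smul_apply, smul_eq_mul, Complex.ofReal_mul]; module

lemma lie_pauliSum (x y : Fin 3 → ℝ) :
    ⁅pauliSum b x, pauliSum b y⁆ = (2 * Complex.I) • pauliSum b (x ⨯₃ y) := by
  rw [Ring.lie_def, pauliSum_mul, pauliSum_mul, dotProduct_comm y x, ← cross_anticomm x y,
    ← neg_one_smul ℝ (x ⨯₃ y), pauliSum_smul]
  push_cast
  module

variable [CompleteSpace H]

lemma isSelfAdjoint_pauliSum (x : Fin 3 → ℝ) : IsSelfAdjoint (pauliSum b x) := by
  have h : ∀ u v : H, star (rankOne ℂ u v) = rankOne ℂ v u := fun u v =>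
    adjoint_rankOne u v
  simp only [IsSelfAdjoint, pauliSum, pauli, Fin.isValue, cons_val_zero, cons_val_one, cons_val,
    star_add, star_smul, star_sub, h, Complex.star_def, Complex.conj_ofReal, Complex.conj_I]
  module

lemma exists_eq_pauliSum {A : H →L[ℂ] H} (hA : IsSelfAdjoint A)
    (ht : LinearMap.trace ℂ H (A : H →ₗ[ℂ] H) = 0) : ∃ x, A = pauliSum b x := by
  have hs : ∀ i j, inner ℂ (b i) (A (b j)) = starRingEnd ℂ (inner ℂ (b j) (A (b i))) := by
    intro i j
    rw [inner_conj_symm, ← ContinuousLinearMap.adjoint_inner_left, hA.adjoint_eq]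
  have h00 : ((inner ℂ (b 0) (A (b 0))).re : ℂ) = inner ℂ (b 0) (A (b 0)) :=
    Complex.conj_eq_iff_re.mp (hs 0 0).symm
  have h11 : inner ℂ (b 1) (A (b 1)) = -inner ℂ (b 0) (A (b 0)) := by
    rw [LinearMap.trace_eq_sum_inner _ b, Fin.sum_univ_two] at ht
    exact eq_neg_of_add_eq_zero_right ht
  refine ⟨![(inner ℂ (b 1) (A (b 0))).re, (inner ℂ (b 1) (A (b 0))).im,
    (inner ℂ (b 0) (A (b 0))).re], ?_⟩
  apply ext_orthonormalBasis_two b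
  · refine (b.sum_repr' (A (b 0))).symm.trans ?_
    rw [pauliSum_apply_zero, Fin.sum_univ_two]
    simp only [cons_val_zero, cons_val_one, cons_val, h00, Complex.re_add_im]
  · refine (b.sum_repr' (A (b 1))).symm.trans ?_
    rw [pauliSum_apply_one, Fin.sum_univ_two, hs 0 1, h11]
    simp only [cons_val_zero, cons_val_one, cons_val, h00]
    rw [neg_smul, ← sub_eq_add_neg]
    congr 2
    generalize inner ℂ (b 1) (A (b 0)) = z
    apply Complex.ext <;> simp

/-- The half-turn about `x + y` exchanges two vectors of equal length. It is conjugation by the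
self-adjoint unitary `W` with Pauli coordinates `(x + y) / ‖x + y‖`. When `x + y = 0` there is no
axis, but then the operators differ only by sign. -/
lemma IsUnitarilyInvariantNorm.pauliSum_eq_of_dotProduct_eq {N : Seminorm ℂ (H →L[ℂ] H)}
    (hN : IsUnitarilyInvariantNorm N) {x y : Fin 3 → ℝ} (h : x ⬝ᵥ x = y ⬝ᵥ y) :
    N (pauliSum b x) = N (pauliSum b y) := by
  by_cases hxy : x + y = 0
  · rw [eq_neg_of_add_eq_zero_left hxy, ← neg_one_smul ℝ y, pauliSum_smul]
    simp
  have hk : 0 < (x + y) ⬝ᵥ (x + y) :=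
    lt_of_le_of_ne (dotProduct_self_nonneg _) fun h => hxy (dotProduct_self_eq_zero.mp h.symm)
  set k : ℝ := (x + y) ⬝ᵥ (x + y) with hkd
  set W : H →L[ℂ] H := pauliSum b ((Real.sqrt k)⁻¹ • (x + y)) with hW
  have hWs : star W = W := isSelfAdjoint_pauliSum b _
  have hsq : Real.sqrt k * Real.sqrt k = k := Real.mul_self_sqrt hk.le
  have hsq0 : Real.sqrt k ≠ 0 := (Real.sqrt_pos.mpr hk).ne'
  have hWW : W * W = 1 := by
    rw [hW, pauliSum_mul, cross_self, smul_dotProduct, dotProduct_smul, smul_eq_mul, smul_eq_mul,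
      ← hkd]
    have : (Real.sqrt k)⁻¹ * ((Real.sqrt k)⁻¹ * k) = 1 := by
      field_simp; rw [sq, hsq]
    rw [this]
    simp [pauliSum]
  have hWu : W ∈ unitary (H →L[ℂ] H) := by
    rw [Unitary.mem_iff, hWs]; exact ⟨hWW, hWW⟩
  have hconj : W * pauliSum b x * W = pauliSum b y := by
    have hr : pauliSum b x * pauliSum b x = pauliSum b y * pauliSum b y := by
      rw [pauliSum_mul, pauliSum_mul, h, cross_self, cross_self]
    have e : (pauliSum b x + pauliSum b y) * pauliSum b x =
        pauliSum b y * (pauliSum b x + pauliSum b y) := by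
      rw [add_mul, mul_add, hr, add_comm]
    have hWd : W = ((Real.sqrt k)⁻¹ : ℂ) • (pauliSum b x + pauliSum b y) := by
      rw [hW, pauliSum_smul, pauliSum_add, Complex.ofReal_inv]
    have e' : W * pauliSum b x = pauliSum b y * W := by
      rw [hWd, smul_mul_assoc, e, mul_smul_comm]
    rw [e', mul_assoc, hWW, mul_one]
  rw [← hconj, hN.unitary_mul_mul W hWu W hWu]

lemma IsUnitarilyInvariantNorm.pauliSum_eq {N : Seminorm ℂ (H →L[ℂ] H)}
    (hN : IsUnitarilyInvariantNorm N) (x : Fin 3 → ℝ) :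
    N (pauliSum b x) = Real.sqrt (x ⬝ᵥ x) * N (pauliSum b ![0, 0, 1]) := by
  have h : x ⬝ᵥ x = (Real.sqrt (x ⬝ᵥ x) • ![0, 0, 1]) ⬝ᵥ (Real.sqrt (x ⬝ᵥ x) • ![0, 0, 1]) := by
    rw [smul_dotProduct, dotProduct_smul, smul_eq_mul, smul_eq_mul, ← mul_assoc,
      Real.mul_self_sqrt (dotProduct_self_nonneg x)]
    simp [vec3_dotProduct]
  rw [hN.pauliSum_eq_of_dotProduct_eq b h, pauliSum_smul, map_smul_eq_mul, Complex.norm_real,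
    Real.norm_eq_abs, abs_of_nonneg (Real.sqrt_nonneg _)]

variable [FiniteDimensional ℂ H]

/-- In dimension two, a trace-preserving, star-preserving, unital linear map that preserves a
unitarily invariant norm of commutators of self-adjoint operators is a Jordan homomorphism. -/
theorem map_sq_of_finrank_eq_two (hn : finrank ℂ H = 2) {N : Seminorm ℂ (H →L[ℂ] H)}
    (hN : IsUnitarilyInvariantNorm N) (ψ : (H →L[ℂ] H) →ₗ[ℂ] (H →L[ℂ] H))
    (hstar : ∀ X, ψ (star X) = star (ψ X))
    (htr : ∀ A, LinearMap.trace ℂ H (ψ A : H →L[ℂ] H) = LinearMap.trace ℂ H (A : H →L[ℂ] H))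
    (hone : ψ 1 = 1)
    (hlie : ∀ A B, IsSelfAdjoint A → IsSelfAdjoint B → N ⁅ψ A, ψ B⁆ = N ⁅A, B⁆)
    (A : H →L[ℂ] H) : ψ (A * A) = ψ A * ψ A := by
  let b : OrthonormalBasis (Fin 2) ℂ H := (stdOrthonormalBasis ℂ H).reindex (finCongr hn)
  have htr0 : ∀ x, LinearMap.trace ℂ H (pauliSum b x : H →L[ℂ] H) = 0 := by
    intro x
    rw [LinearMap.trace_eq_sum_inner _ b, Fin.sum_univ_two]
    simp [pauliSum_apply_zero, pauliSum_apply_one, inner_add_right, inner_sub_right,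
      inner_smul_right, b.inner_eq_ite, -Complex.coe_smul]
  have hex : ∀ x, ∃ y, ψ (pauliSum b x) = pauliSum b y := fun x =>
    exists_eq_pauliSum b (by rw [IsSelfAdjoint, ← hstar, (isSelfAdjoint_pauliSum b x).star_eq])
      (by rw [htr, htr0])
  obtain ⟨u, hu⟩ := hex ![1, 0, 0]
  obtain ⟨v, hv⟩ := hex ![0, 1, 0]
  obtain ⟨w, hw⟩ := hex ![0, 0, 1]
  have hκ : N (pauliSum b ![0, 0, 1]) ≠ 0 := by
    intro h
    have h0 := DFunLike.congr_fun (hN.eq_zero_of_apply_eq_zero _ h) (b 0)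
    rw [pauliSum_apply_zero] at h0
    have : b 0 = 0 := by simpa using h0
    exact b.toBasis.ne_zero 0 (by simpa using this)
  have hψ : ∀ x : Fin 3 → ℝ, ψ (pauliSum b x) = pauliSum b (x 0 • u + x 1 • v + x 2 • w) := by
    intro x
    have hx : x = x 0 • ![1, 0, 0] + x 1 • ![0, 1, 0] + x 2 • ![0, 0, 1] := by
      ext i; fin_cases i <;> simp
    conv_lhs => rw [hx]
    simp only [pauliSum_add, pauliSum_smul, map_add, map_smul, hu, hv, hw]
  -- The commutator hypothesis becomes equality of lengths of cross products; polarising in the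
  -- second factor gives inner products of cross products sharing a factor.
  have hcross : ∀ x y x' y' : Fin 3 → ℝ, ψ (pauliSum b x) = pauliSum b x' →
      ψ (pauliSum b y) = pauliSum b y' → x' ⨯₃ y' ⬝ᵥ x' ⨯₃ y' = x ⨯₃ y ⬝ᵥ x ⨯₃ y := by
    intro x y x' y' hx hy
    have h := hlie _ _ (isSelfAdjoint_pauliSum b x) (isSelfAdjoint_pauliSum b y)
    rw [hx, hy, lie_pauliSum, lie_pauliSum, map_smul_eq_mul, map_smul_eq_mul,
      hN.pauliSum_eq b (x' ⨯₃ y'), hN.pauliSum_eq b (x ⨯₃ y)] at h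
    have h' := mul_right_cancel₀ hκ (mul_left_cancel₀ (by simp) h)
    exact (Real.sqrt_inj (dotProduct_self_nonneg _) (dotProduct_self_nonneg _)).mp h'
  have polar : ∀ x y z : Fin 3 → ℝ, x ⨯₃ (y + z) ⬝ᵥ x ⨯₃ (y + z) =
      x ⨯₃ y ⬝ᵥ x ⨯₃ y + 2 * (x ⨯₃ y ⬝ᵥ x ⨯₃ z) + x ⨯₃ z ⬝ᵥ x ⨯₃ z := by
    intro x y z
    rw [map_add, add_dotProduct, dotProduct_add, dotProduct_add,
      dotProduct_comm (x ⨯₃ z) (x ⨯₃ y)]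
    ring
  have hcross' : ∀ x y z x' y' z' : Fin 3 → ℝ, ψ (pauliSum b x) = pauliSum b x' →
      ψ (pauliSum b y) = pauliSum b y' → ψ (pauliSum b z) = pauliSum b z' →
      x' ⨯₃ y' ⬝ᵥ x' ⨯₃ z' = x ⨯₃ y ⬝ᵥ x ⨯₃ z := by
    intro x y z x' y' z' hx hy hz
    have h := hcross x (y + z) x' (y' + z') hx (by
      rw [pauliSum_add, pauliSum_add, map_add, hy, hz])
    rw [polar, polar, hcross x y x' y' hx hy, hcross x z x' z' hx hz] at h
    linarith
  obtain ⟨huu, hvv, hww, huv, huw, hvw⟩ := dotProduct_eq_of_cross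
    (by rw [hcross' _ _ _ _ _ _ hu hv hv]; simp [cross_apply])
    (by rw [hcross' _ _ _ _ _ _ hu hw hw]; simp [cross_apply])
    (by rw [hcross' _ _ _ _ _ _ hv hw hw]; simp [cross_apply])
    (by rw [hcross' _ _ _ _ _ _ hu hv hw]; simp [cross_apply])
    (by rw [hcross' _ _ _ _ _ _ hv hu hw]; simp [cross_apply])
    (by rw [hcross' _ _ _ _ _ _ hw hu hv]; simp [cross_apply])
  have hiso : ∀ x : Fin 3 → ℝ, (x 0 • u + x 1 • v + x 2 • w) ⬝ᵥ (x 0 • u + x 1 • v + x 2 • w) =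
      x ⬝ᵥ x := by
    intro x
    simp only [add_dotProduct, dotProduct_add, smul_dotProduct, dotProduct_smul, huu, hvv, hww,
      huv, huw, hvw, dotProduct_comm v u, dotProduct_comm w u, dotProduct_comm w v, smul_eq_mul]
    rw [vec3_dotProduct]
    ring
  refine map_sq_of_forall_isSelfAdjoint ψ (fun A hA => ?_) A
  set t : ℂ := LinearMap.trace ℂ H (A : H →ₗ[ℂ] H) / 2 with ht
  have htc : star t = t := by
    rw [ht, star_div₀, ← trace_star, hA.star_eq]; simp
  obtain ⟨x, hx⟩ := exists_eq_pauliSum b (A := A - t • 1)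
    (by rw [IsSelfAdjoint, star_sub, star_smul, htc, star_one, hA.star_eq])
    (by
      have e : LinearMap.trace ℂ H ((1 : H →L[ℂ] H) : H →ₗ[ℂ] H) = 2 := by
        rw [show ((1 : H →L[ℂ] H) : H →ₗ[ℂ] H) = LinearMap.id from rfl, LinearMap.trace_id, hn]
        norm_num
      rw [ContinuousLinearMap.toLinearMap_sub, ContinuousLinearMap.toLinearMap_smul, map_sub,
        map_smul, e, ht]
      simp)
  -- After splitting off the scalar part `t`, the square involves the Pauli vector only linearly and
  -- through its squared length, both of which `ψ` respects.
  rw [eq_add_of_sub_eq' hx]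
  have sq : ∀ x, (t • 1 + pauliSum b x) * (t • 1 + pauliSum b x) =
      (t * t) • (1 : H →L[ℂ] H) + (2 * t) • pauliSum b x + ((x ⬝ᵥ x : ℝ) : ℂ) • 1 := by
    intro x
    have : pauliSum b x * pauliSum b x = ((x ⬝ᵥ x : ℝ) : ℂ) • 1 := by
      rw [pauliSum_mul, cross_self]; simp [pauliSum]
    rw [add_mul, mul_add, mul_add, this]
    simp only [smul_mul_assoc, mul_smul_comm, one_mul, mul_one]
    module
  rw [sq, map_add, map_add, map_add, map_smul, map_smul, map_smul, map_smul, hone, hψ, sq, hiso]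

end Pauli

/-! ### Implementation by unitaries and antiunitaries. -/

section Implementation

variable {H : Type*} [NormedAddCommGroup H] [InnerProductSpace ℂ H]

/-- The algebra of operators is prime. -/
lemma ContinuousLinearMap.eq_zero_or_eq_zero_of_forall_mul_mul_eq_zero (a b : H →L[ℂ] H)
    (h : ∀ x, a * x * b = 0) : a = 0 ∨ b = 0 := by
  by_contra! hc
  obtain ⟨y, hy⟩ : ∃ y, b y ≠ 0 := by
    by_contra! h'; exact hc.2 (ContinuousLinearMap.ext h')
  refine hc.1 (ContinuousLinearMap.ext fun u => ?_)
  -- This rank-one operator sends the nonzero vector `b y` to a nonzero multiple of the arbitrary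
  -- vector `u`.
  have e := DFunLike.congr_fun (h (rankOne ℂ u (b y))) y
  change a (rankOne ℂ u (b y) (b y)) = 0 at e
  rw [rankOne_apply, map_smul, smul_eq_zero] at e
  exact e.resolve_left (inner_self_ne_zero.mpr hy)

lemma Antiunitary.conj_apply (U : Antiunitary H) (A : H →L[ℂ] H) (x : H) :
    U.conj A x = U (A (U.symm x)) := rfl

/-- Every orthonormal basis is fixed by an antiunitary involution. -/
lemma exists_antiunitary_involution {ι : Type*} [Fintype ι] (b : OrthonormalBasis ι ℂ H) :
    ∃ J : Antiunitary H, (∀ x, J (J x) = x) ∧ (∀ i, J (b i) = b i) ∧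
      ∀ x y, inner ℂ (J x) (J y) = inner ℂ y x := by
  classical
  let f : H →ₛₗ[starRingEnd ℂ] H :=
    { toFun := fun x => ∑ i, starRingEnd ℂ (inner ℂ (b i) x) • b i
      map_add' := fun x y => by simp [add_smul, Finset.sum_add_distrib]
      map_smul' := fun c x => by simp [Finset.smul_sum, smul_smul] }
  have hf : ∀ x, f x = ∑ i, starRingEnd ℂ (inner ℂ (b i) x) • b i := fun _ => rfl
  have hb : ∀ i x, inner ℂ (b i) (f x) = starRingEnd ℂ (inner ℂ (b i) x) := by
    intro i x
    rw [hf, inner_sum, Finset.sum_eq_single i]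
    · rw [inner_smul_right, b.inner_eq_one, mul_one]
    · intro j _ hj
      rw [inner_smul_right, b.inner_eq_zero hj.symm, mul_zero]
    · simp
  have hff : Function.Involutive f := by
    intro x
    conv_lhs => rw [hf]
    simp only [hb, Complex.conj_conj]
    exact b.sum_repr' x
  have hin : ∀ x y, inner ℂ (f x) (f y) = inner ℂ y x := by
    intro x y
    rw [← b.sum_inner_mul_inner (f x) (f y), ← b.sum_inner_mul_inner y x]
    refine Finset.sum_congr rfl fun i _ => ?_
    rw [hb, ← inner_conj_symm (f x) (b i), hb, Complex.conj_conj, inner_conj_symm, mul_comm]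
  refine ⟨{ LinearEquiv.ofInvolutive f hff with norm_map' := fun x => ?_ }, hff, fun i => ?_, hin⟩
  · change ‖f x‖ = ‖x‖
    rw [norm_eq_sqrt_re_inner (𝕜 := ℂ) (f x), hin, ← norm_eq_sqrt_re_inner]
  · change f (b i) = b i
    rw [hf, Finset.sum_eq_single i]
    · simp
    · intro j _ hj
      simp [b.inner_eq_zero hj]
    · simp

variable [CompleteSpace H] [FiniteDimensional ℂ H]

/-- A bijective multiplicative star-preserving linear map on operators is unitarily implemented. -/
lemma exists_linearIsometryEquiv_of_map_mul (χ : (H →L[ℂ] H) →ₗ[ℂ] (H →L[ℂ] H))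
    (hbij : Function.Bijective χ) (hstar : ∀ X, χ (star X) = star (χ X))
    (hmul : ∀ A B, χ (A * B) = χ A * χ B) :
    ∃ U : H ≃ₗᵢ[ℂ] H, ∀ A x, χ A x = U (A (U.symm x)) := by
  let f : (H →L[ℂ] H) ≃⋆ₐ[ℂ] (H →L[ℂ] H) :=
    { Equiv.ofBijective χ hbij with
      map_mul' := hmul
      map_add' := map_add χ
      map_star' := hstar
      map_smul' := map_smul χ }
  obtain ⟨U, hU⟩ := StarAlgEquiv.eq_linearIsometryEquivConjStarAlgEquiv f
    (LinearMap.continuous_of_finiteDimensional χ)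
  refine ⟨U, fun A x => ?_⟩
  have : f A = U.conjStarAlgEquiv A := by rw [hU]
  exact DFunLike.congr_fun this x

/-- The transposition `A ↦ J A* J` is a complex-linear, star-preserving anti-automorphism and an
involution. Composing with it makes `ψ` multiplicative, and on self-adjoint operators the star
disappears. -/
lemma exists_antiunitary_of_map_mul_rev (ψ : (H →L[ℂ] H) →ₗ[ℂ] (H →L[ℂ] H))
    (hbij : Function.Bijective ψ) (hstar : ∀ X, ψ (star X) = star (ψ X))
    (hmul : ∀ A B, ψ (A * B) = ψ B * ψ A) {J : Antiunitary H} (hJ : ∀ x, J (J x) = x)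
    (hinner : ∀ x y, inner ℂ (J x) (J y) = inner ℂ y x) :
    ∃ U : H ≃ₗᵢ[ℂ] H, ∀ A, IsSelfAdjoint A → ∀ x, ψ A x = U (J (A (J (U.symm x)))) := by
  have hJs : ∀ x, J.symm x = J x := fun x => J.symm_apply_eq.mpr (hJ x).symm
  have hca : ∀ A x, J.conj A x = J (A (J x)) := fun A x => by
    rw [Antiunitary.conj_apply, hJs]
  have hinner' : ∀ x y, inner ℂ (J x) y = inner ℂ (J y) x := fun x y => by
    conv_lhs => rw [← hJ y, hinner]
  have hcs : ∀ A, star (J.conj A) = J.conj (star A) := by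
    intro A
    refine ((ContinuousLinearMap.eq_adjoint_iff _ _).mpr fun x y => ?_).symm
    rw [hca, hca, hinner', ContinuousLinearMap.star_eq_adjoint,
      ContinuousLinearMap.adjoint_inner_right, ← inner_conj_symm, hinner', inner_conj_symm,
      ← inner_conj_symm, hinner', inner_conj_symm]
  have hcc : ∀ A, J.conj (J.conj A) = A := fun A => by
    ext x; rw [hca, hca, hJ, hJ]
  let τ : (H →L[ℂ] H) →ₗ[ℂ] (H →L[ℂ] H) :=
    { toFun := fun A => J.conj (star A)
      map_add' := fun A B => by ext x; simp [hca]
      map_smul' := fun c A => by ext x; simp [hca, map_smulₛₗ] }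
  have hτ : ∀ A, τ A = J.conj (star A) := fun _ => rfl
  have hττ : Function.Involutive τ := fun A => by rw [hτ, hτ, hcs, star_star, hcc]
  obtain ⟨U, hU⟩ := exists_linearIsometryEquiv_of_map_mul (ψ ∘ₗ τ) (hbij.comp hττ.bijective)
    (fun X => by rw [LinearMap.comp_apply, LinearMap.comp_apply, hτ, hτ, ← hcs, hstar])
    (fun A B => by
      have e : τ (A * B) = τ B * τ A := by
        ext x
        change _ = τ B (τ A x)
        simp only [hτ, hca, hJ, star_mul]
        rfl
      rw [LinearMap.comp_apply, e, hmul]; rfl)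
  refine ⟨U, fun A hA x => ?_⟩
  have h := hU (τ A) x
  rw [LinearMap.comp_apply, hττ] at h
  rw [h, hτ, hA.star_eq, hca]

end Implementation

/-! ### Removing the scalar ambiguity by the trace. -/

section Normalization

variable {H : Type*} [NormedAddCommGroup H] [InnerProductSpace ℂ H]

lemma lie_eq_of_smul_add_smul_one {A B A' B' : H →L[ℂ] H} {c z w : ℂ}
    (hA : A = c • A' + z • 1) (hB : B = c • B' + w • 1) : ⁅A, B⁆ = (c * c) • ⁅A', B'⁆ := by
  subst hA hB
  simp only [Ring.lie_def, add_mul, mul_add, smul_mul_assoc, mul_smul_comm, one_mul, mul_one]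
  module

variable [FiniteDimensional ℂ H]

/-- The trace detects scalars. This turns properties of `θ` valid modulo scalars into exact ones for
`ψ`. -/
lemma eq_of_sub_eq_smul_one {A B : H →L[ℂ] H} {z : ℂ}
    (htr : LinearMap.trace ℂ H (A : H →ₗ[ℂ] H) = LinearMap.trace ℂ H (B : H →ₗ[ℂ] H))
    (h : A - B = z • 1) : A = B := by
  have ht : LinearMap.trace ℂ H ((A - B : H →L[ℂ] H) : H →ₗ[ℂ] H) = 0 := by
    rw [ContinuousLinearMap.toLinearMap_sub, map_sub, htr, sub_self]
  rw [h] at ht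
  rw [smul_one_eq_zero_of_trace_eq_zero ht] at h
  exact sub_eq_zero.mp h

variable [CompleteSpace H]

variable {θ : (H →L[ℂ] H) ≃ₗ[ℂ] (H →L[ℂ] H)} {ψ : (H →L[ℂ] H) →ₗ[ℂ] (H →L[ℂ] H)} {c : ℝ}

lemma map_star_of_trace_preserving (hc : c ≠ 0) (hstar : ∀ X, θ (star X) = star (θ X))
    (hψ : ∀ A, ∃ z : ℂ, θ A = (c : ℂ) • ψ A + z • 1)
    (htr : ∀ A, LinearMap.trace ℂ H (ψ A : H →L[ℂ] H) = LinearMap.trace ℂ H (A : H →L[ℂ] H))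
    (X : H →L[ℂ] H) : ψ (star X) = star (ψ X) := by
  have hc' : (c : ℂ) ≠ 0 := by exact_mod_cast hc
  obtain ⟨z, hz⟩ := hψ X
  obtain ⟨z', hz'⟩ := hψ (star X)
  rw [hstar, hz, star_add, star_smul, star_smul, star_one, Complex.star_def,
    Complex.conj_ofReal] at hz'
  refine eq_of_sub_eq_smul_one (z := (c : ℂ)⁻¹ * (star z - z')) ?_ ?_
  · rw [htr, trace_star, trace_star, htr]
  · rw [mul_smul, eq_inv_smul_iff₀ hc', smul_sub, sub_smul, sub_eq_sub_iff_add_eq_add, ← hz',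
      Complex.star_def]
    abel

lemma bijective_of_trace_preserving
    (hcomm : ∀ A X, IsSelfAdjoint A → (Commute A X ↔ Commute (θ A) (θ X)))
    (hψ : ∀ A, ∃ z : ℂ, θ A = (c : ℂ) • ψ A + z • 1)
    (htr : ∀ A, LinearMap.trace ℂ H (ψ A : H →L[ℂ] H) = LinearMap.trace ℂ H (A : H →L[ℂ] H)) :
    Function.Bijective ψ := by
  have hinj : Function.Injective ψ := by
    rw [injective_iff_map_eq_zero]
    intro A hA
    obtain ⟨z, hz⟩ := hψ A
    rw [hA, smul_zero, zero_add] at hz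
    obtain ⟨z', hz'⟩ := exists_smul_one_of_apply_eq_smul_one hcomm hz
    refine eq_of_sub_eq_smul_one (z := z') ?_ (by rw [hz', sub_zero])
    rw [← htr, hA]
  exact ⟨hinj, LinearMap.surjective_of_injective hinj⟩

lemma map_one_of_trace_preserving (hc : c ≠ 0)
    (hcomm : ∀ A X, IsSelfAdjoint A → (Commute A X ↔ Commute (θ A) (θ X)))
    (hψ : ∀ A, ∃ z : ℂ, θ A = (c : ℂ) • ψ A + z • 1)
    (htr : ∀ A, LinearMap.trace ℂ H (ψ A : H →L[ℂ] H) = LinearMap.trace ℂ H (A : H →L[ℂ] H)) :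
    ψ 1 = 1 := by
  have hc' : (c : ℂ) ≠ 0 := by exact_mod_cast hc
  obtain ⟨s, hs⟩ := exists_apply_one_eq_smul_one hcomm
  obtain ⟨z, hz⟩ := hψ 1
  refine eq_of_sub_eq_smul_one (z := (c : ℂ)⁻¹ * (s - z) - 1) (htr 1) ?_
  rw [sub_smul, one_smul, sub_left_inj, mul_smul, eq_inv_smul_iff₀ hc', sub_smul, ← hs, hz,
    add_sub_cancel_right]

/-- A star-preserving linear bijection preserving a unitarily invariant norm of commutators of
self-adjoint operators is a real multiple of a Jordan automorphism modulo scalars. -/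
theorem exists_jordan_of_two_le (hn : 2 ≤ finrank ℂ H) {N : Seminorm ℂ (H →L[ℂ] H)}
    (hN : IsUnitarilyInvariantNorm N) (hstar : ∀ X, θ (star X) = star (θ X))
    (hcomm : ∀ A X, IsSelfAdjoint A → (Commute A X ↔ Commute (θ A) (θ X)))
    (hlie : ∀ A B, IsSelfAdjoint A → IsSelfAdjoint B → N ⁅θ A, θ B⁆ = N ⁅A, B⁆) :
    ∃ (c : ℝ) (ψ : (H →L[ℂ] H) →ₗ[ℂ] (H →L[ℂ] H)),
      (∀ A, ∃ z : ℂ, θ A = (c : ℂ) • ψ A + z • 1) ∧ Function.Bijective ψ ∧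
      (∀ X, ψ (star X) = star (ψ X)) ∧ ∀ A, ψ (A * A) = ψ A * ψ A := by
  have : Nontrivial H := nontrivial_of_finrank_pos (R := ℂ) (by omega)
  rcases hn.eq_or_lt' with hn2 | hn3
  -- The factor `1` is enough in dimension two: `A ↦ tr(A) - A` is there a Jordan automorphism, so a
  -- minus sign is absorbed into `ψ`.
  · obtain ⟨ψ, hψ, htr⟩ := exists_trace_preserving (θ : (H →L[ℂ] H) →ₗ[ℂ] (H →L[ℂ] H))
      (c := 1) one_ne_zero
    have hs := map_star_of_trace_preserving one_ne_zero hstar hψ htr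
    refine ⟨1, ψ, hψ, bijective_of_trace_preserving hcomm hψ htr, hs,
      map_sq_of_finrank_eq_two hn2 hN ψ hs htr
        (map_one_of_trace_preserving one_ne_zero hcomm hψ htr) fun A B hA hB => ?_⟩
    obtain ⟨z, hz⟩ := hψ A
    obtain ⟨w, hw⟩ := hψ B
    rw [← hlie A B hA hB]
    have := lie_eq_of_smul_add_smul_one hz hw
    rw [LinearEquiv.coe_coe] at this
    rw [this]; simp
  · obtain ⟨c, ψ, hc, hψ, htr, hsq⟩ := exists_jordan_of_three_le hn3 θ hstar hcomm
    exact ⟨c, ψ, hψ, bijective_of_trace_preserving hcomm hψ htr,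
      map_star_of_trace_preserving hc hstar hψ htr, hsq⟩

end Normalization

/-! ### Complex-linear extension from the self-adjoint part. -/

section Complexification

variable {A : Type*} [AddCommGroup A] [Module ℂ A] [StarAddMonoid A] [StarModule ℂ A]

/-- The complex-linear extension of a real-linear map between self-adjoint parts. -/
noncomputable def complexify (L : selfAdjoint A →+ selfAdjoint A)
    (hL : ∀ (r : ℝ) (X Y : selfAdjoint A), (Y : A) = (r : ℂ) • (X : A) →
      (L Y : A) = (r : ℂ) • (L X : A)) : A →ₗ[ℂ] A where
  toFun X := (L (realPart X) : A) + Complex.I • (L (imaginaryPart X) : A)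
  map_add' X Y := by simp only [map_add, AddSubgroup.coe_add]; module
  map_smul' z X := by
    have h : ∀ (r : ℝ) (X : selfAdjoint A), (L (r • X) : A) = (r : ℂ) • (L X : A) := fun r X =>
      hL r X _ (by rw [selfAdjoint.val_smul, Complex.coe_smul])
    simp only [realPart_smul, imaginaryPart_smul, map_sub, map_add, AddSubgroup.coe_add,
      AddSubgroup.coe_sub, h, RingHom.id_apply, smul_add, smul_smul]
    conv_rhs => rw [← Complex.re_add_im z]
    match_scalars
    · ring
    · linear_combination (-(z.im : ℂ)) * Complex.I_mul_I

variable (L : selfAdjoint A →+ selfAdjoint A)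
  (hL : ∀ (r : ℝ) (X Y : selfAdjoint A), (Y : A) = (r : ℂ) • (X : A) →
    (L Y : A) = (r : ℂ) • (L X : A))

lemma complexify_apply (X : A) :
    complexify L hL X = (L (realPart X) : A) + Complex.I • (L (imaginaryPart X) : A) := rfl

lemma realPart_complexify (X : A) : realPart (complexify L hL X) = L (realPart X) := by
  rw [complexify_apply, map_add, realPart_I_smul, (L (imaginaryPart X)).2.imaginaryPart, neg_zero,
    add_zero]
  exact Subtype.ext (L (realPart X)).2.coe_realPart

lemma imaginaryPart_complexify (X : A) :
    imaginaryPart (complexify L hL X) = L (imaginaryPart X) := by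
  rw [complexify_apply, map_add, imaginaryPart_I_smul, (L (realPart X)).2.imaginaryPart, zero_add]
  exact Subtype.ext (L (imaginaryPart X)).2.coe_realPart

lemma complexify_coe (X : selfAdjoint A) : complexify L hL (X : A) = L X := by
  rw [complexify_apply, X.2.imaginaryPart, map_zero]
  have : realPart (X : A) = X := Subtype.ext X.2.coe_realPart
  rw [this]; simp

lemma complexify_star (X : A) : complexify L hL (star X) = star (complexify L hL X) := by
  have hr : realPart (star X) = realPart X := by
    ext; simp [realPart_apply_coe, add_comm]
  have hi : imaginaryPart (star X) = -imaginaryPart X := by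
    ext; simp [imaginaryPart_apply_coe]; module
  rw [complexify_apply, complexify_apply, hr, hi, star_add, star_smul,
    (L (realPart X)).2.star_eq, (L (imaginaryPart X)).2.star_eq]
  simp

lemma complexify_injective (hinj : Function.Injective L) :
    Function.Injective (complexify L hL) := by
  rw [injective_iff_map_eq_zero] at hinj ⊢
  intro X hX
  have hr := realPart_complexify L hL X
  have hi := imaginaryPart_complexify L hL X
  rw [hX, map_zero] at hr hi
  rw [← realPart_add_I_smul_imaginaryPart X, hinj _ hr.symm, hinj _ hi.symm]
  simp

end Complexification

/-- An operator commuting with a self-adjoint `A` has an adjoint commuting with `A`. Commutativity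
preservation thereby passes from self-adjoint `X` to all `X`. -/
lemma commute_iff_commute_realPart_imaginaryPart {R : Type*} [Ring R] [Algebra ℂ R] [StarRing R] [StarModule ℂ R]
    {A : R} (hA : IsSelfAdjoint A) (X : R) :
    Commute A X ↔ Commute A ((realPart X : selfAdjoint R) : R) ∧ Commute A ((imaginaryPart X : selfAdjoint R) : R) := by
  constructor
  · intro h
    have hs : Commute A (star X) := by simpa [hA.star_eq] using h.star_star
    rw [realPart_apply_coe, imaginaryPart_apply_coe]
    exact ⟨(h.add_right hs).smul_right _, ((h.sub_right hs).smul_right _).smul_right _⟩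
  · rintro ⟨h1, h2⟩
    rw [← realPart_add_I_smul_imaginaryPart X]
    exact h1.add_right (h2.smul_right _)

/-! ### From `φ` to a complex-linear bijection. -/

section Main

variable {H : Type*} [NormedAddCommGroup H] [InnerProductSpace ℂ H]

/-- The real part of the normalized trace. -/
noncomputable def normalizedTrace (A : H →L[ℂ] H) : ℝ :=
  (LinearMap.trace ℂ H (A : H →ₗ[ℂ] H)).re / finrank ℂ H

lemma normalizedTrace_add (A B : H →L[ℂ] H) :
    normalizedTrace (A + B) = normalizedTrace A + normalizedTrace B := by
  simp [normalizedTrace, add_div]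

lemma normalizedTrace_smul (r : ℝ) (A : H →L[ℂ] H) :
    normalizedTrace ((r : ℂ) • A) = r * normalizedTrace A := by
  rw [normalizedTrace, normalizedTrace, ContinuousLinearMap.toLinearMap_smul, map_smul, smul_eq_mul,
    Complex.re_ofReal_mul, mul_div_assoc]

variable [CompleteSpace H]

lemma IsUnitarilyInvariantNorm.lie_eq_zero_iff {N : Seminorm ℂ (H →L[ℂ] H)}
    (hN : IsUnitarilyInvariantNorm N) (A B : H →L[ℂ] H) : N ⁅A, B⁆ = 0 ↔ Commute A B := by
  rw [commute_iff_lie_eq]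
  exact ⟨hN.eq_zero_of_apply_eq_zero _, fun h => by rw [h, map_zero]⟩

lemma mul_linearIsometryEquiv_mul_star (U : H ≃ₗᵢ[ℂ] H) :
    ∃ V ∈ unitary (H →L[ℂ] H), ∀ (A : H →L[ℂ] H) (x : H), (V * A * star V) x = U (A (U.symm x)) := by
  refine ⟨_, (Unitary.linearIsometryEquiv.symm U).2, fun A x => ?_⟩
  have h := Unitary.conjStarAlgAut_symm_unitaryLinearIsometryEquiv (𝕜 := ℂ) U
  have h' := DFunLike.congr_fun (DFunLike.congr_fun h A) x
  simp at h' ⊢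

/-- The factor `c` scales commutators by `c²`, so one noncommuting pair on which the Jordan part
keeps the norm determines `c` up to sign. -/
lemma eq_one_or_eq_neg_one_of_lie {N : Seminorm ℂ (H →L[ℂ] H)}
    (hN : IsUnitarilyInvariantNorm N) {c : ℝ} {A B A' B' : H →L[ℂ] H} {z w : ℂ} {X Y : H →L[ℂ] H}
    (hX : X = (c : ℂ) • A' + z • 1) (hY : Y = (c : ℂ) • B' + w • 1)
    (hXY : N ⁅X, Y⁆ = N ⁅A, B⁆) (hne : ⁅A, B⁆ ≠ 0) (h : N ⁅A', B'⁆ = N ⁅A, B⁆) :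
    c = 1 ∨ c = -1 := by
  have h0 : N ⁅A, B⁆ ≠ 0 := fun h => hne (hN.eq_zero_of_apply_eq_zero _ h)
  rw [lie_eq_of_smul_add_smul_one hX hY, map_smul_eq_mul, h] at hXY
  have := mul_right_cancel₀ h0 (hXY.trans (one_mul _).symm)
  rw [norm_mul, Complex.norm_real, Real.norm_eq_abs, abs_mul_abs_self] at this
  exact mul_self_eq_one_iff.mp this

lemma coe_map_eq_smul (φ : selfAdjoint (H →L[ℂ] H) →ₗ[ℝ] selfAdjoint (H →L[ℂ] H)) (r : ℝ)
    (X Y : selfAdjoint (H →L[ℂ] H)) (h : (Y : H →L[ℂ] H) = (r : ℂ) • (X : H →L[ℂ] H)) :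
    (φ Y : H →L[ℂ] H) = (r : ℂ) • (φ X : H →L[ℂ] H) := by
  have hY : Y = r • X := Subtype.ext (by rw [h]; ext x; simp)
  rw [hY, map_smul]
  ext x; simp

variable [FiniteDimensional ℂ H]

lemma eq_normalizedTrace_smul_one {A : H →L[ℂ] H} (hA : IsSelfAdjoint A)
    (h : ∃ z : ℂ, A = z • 1) : A = (normalizedTrace A : ℂ) • 1 := by
  rcases subsingleton_or_nontrivial H with hs | hs
  · exact Subsingleton.elim _ _
  obtain ⟨z, rfl⟩ := h
  have hz : star z = z := by
    rw [IsSelfAdjoint, star_smul, star_one] at hA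
    exact smul_left_injective ℂ (one_ne_zero (α := H →L[ℂ] H)) hA
  have hn : (finrank ℂ H : ℝ) ≠ 0 := by exact_mod_cast (finrank_pos (R := ℂ) (M := H)).ne'
  have ht : LinearMap.trace ℂ H ((z • 1 : H →L[ℂ] H) : H →ₗ[ℂ] H) = z * finrank ℂ H := by
    have e : ((z • 1 : H →L[ℂ] H) : H →ₗ[ℂ] H) = z • LinearMap.id := rfl
    rw [e, map_smul, LinearMap.trace_id, smul_eq_mul]
  have hn' : normalizedTrace (z • 1 : H →L[ℂ] H) = z.re := by
    rw [normalizedTrace, ht]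
    simp [hn]
  rw [hn', Complex.conj_eq_iff_re.mp hz]

/-- A real-linear map preserving the norm of commutators agrees modulo scalars with the restriction
of a complex-linear star-preserving bijection. -/
lemma exists_linearEquiv_of_lie [Nontrivial H]
    {N : Seminorm ℂ (H →L[ℂ] H)} (hN : IsUnitarilyInvariantNorm N)
    (φ : selfAdjoint (H →L[ℂ] H) →ₗ[ℝ] selfAdjoint (H →L[ℂ] H))
    (hφ : ∀ A B : selfAdjoint (H →L[ℂ] H),
      N ⁅(φ A : H →L[ℂ] H), (φ B : H →L[ℂ] H)⁆ = N ⁅(A : H →L[ℂ] H), (B : H →L[ℂ] H)⁆) :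
    ∃ θ : (H →L[ℂ] H) ≃ₗ[ℂ] (H →L[ℂ] H),
      (∀ A : selfAdjoint (H →L[ℂ] H), ∃ z : ℂ, (φ A : H →L[ℂ] H) = θ A + z • 1) ∧
      (∀ X, θ (star X) = star (θ X)) ∧
      (∀ A X, IsSelfAdjoint A → (Commute A X ↔ Commute (θ A) (θ X))) ∧
      ∀ A B, IsSelfAdjoint A → IsSelfAdjoint B → N ⁅θ A, θ B⁆ = N ⁅A, B⁆ := by
  -- Since `φ` may kill the identity, `t` times the normalized trace is added. Commutators do not
  -- change, and the identity now has nonzero image.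
  obtain ⟨t, ht⟩ : ∃ t : ℝ, (φ 1 : H →L[ℂ] H) + (t : ℂ) • 1 ≠ 0 := by
    by_cases h : (φ 1 : H →L[ℂ] H) = 0
    · exact ⟨1, by simp [h]⟩
    · exact ⟨0, by simpa using h⟩
  have hs : ∀ A : selfAdjoint (H →L[ℂ] H),
      IsSelfAdjoint ((φ A : H →L[ℂ] H) + ((t * normalizedTrace (A : H →L[ℂ] H) : ℝ) : ℂ) • 1) := by
    intro A
    rw [IsSelfAdjoint, star_add, (φ A).2.star_eq, star_smul, star_one, Complex.star_def,
      Complex.conj_ofReal]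
  let L : selfAdjoint (H →L[ℂ] H) →+ selfAdjoint (H →L[ℂ] H) :=
    AddMonoidHom.mk' (fun A => ⟨_, hs A⟩) fun A B => Subtype.ext (by
      change (φ (A + B) : H →L[ℂ] H) +
          ((t * normalizedTrace ((A : H →L[ℂ] H) + (B : H →L[ℂ] H)) : ℝ) : ℂ) • 1 =
        ((φ A : H →L[ℂ] H) + ((t * normalizedTrace (A : H →L[ℂ] H) : ℝ) : ℂ) • 1) +
          ((φ B : H →L[ℂ] H) + ((t * normalizedTrace (B : H →L[ℂ] H) : ℝ) : ℂ) • 1)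
      rw [map_add, AddSubgroup.coe_add, normalizedTrace_add]
      push_cast
      module)
  have hL : ∀ A, (L A : H →L[ℂ] H) =
      φ A + ((t * normalizedTrace (A : H →L[ℂ] H) : ℝ) : ℂ) • 1 := fun A => rfl
  have hLsmul : ∀ (r : ℝ) (X Y : selfAdjoint (H →L[ℂ] H)),
      (Y : H →L[ℂ] H) = (r : ℂ) • (X : H →L[ℂ] H) →
      (L Y : H →L[ℂ] H) = (r : ℂ) • (L X : H →L[ℂ] H) := by
    intro r X Y h
    rw [hL, hL, coe_map_eq_smul φ r X Y h, h, normalizedTrace_smul]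
    push_cast
    module
  have hLlie : ∀ A B : selfAdjoint (H →L[ℂ] H),
      N ⁅(L A : H →L[ℂ] H), (L B : H →L[ℂ] H)⁆ = N ⁅(A : H →L[ℂ] H), (B : H →L[ℂ] H)⁆ := by
    intro A B
    have h1 : ∀ A, (L A : H →L[ℂ] H) = (1 : ℂ) • (φ A : H →L[ℂ] H) +
        ((t * normalizedTrace (A : H →L[ℂ] H) : ℝ) : ℂ) • 1 := fun A => by rw [one_smul, hL]
    rw [lie_eq_of_smul_add_smul_one (h1 A) (h1 B), mul_one, one_smul, hφ]
  have hLcomm : ∀ A B : selfAdjoint (H →L[ℂ] H),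
      Commute (A : H →L[ℂ] H) (B : H →L[ℂ] H) ↔ Commute (L A : H →L[ℂ] H) (L B : H →L[ℂ] H) := by
    intro A B
    rw [← hN.lie_eq_zero_iff, ← hN.lie_eq_zero_iff, hLlie]
  -- An element of the kernel commutes with every self-adjoint operator, hence is a real multiple of
  -- the identity, whose image is nonzero by the choice of `t`.
  have hLinj : Function.Injective L := by
    rw [injective_iff_map_eq_zero]
    intro A hA
    have hz : ∃ z : ℂ, (A : H →L[ℂ] H) = z • 1 :=
      exists_smul_one_of_forall_isSelfAdjoint_commute fun X hX =>
        (hLcomm ⟨X, hX⟩ A).mpr (by rw [hA]; exact Commute.zero_right _)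
    have hA1 := eq_normalizedTrace_smul_one A.2 hz
    have h1 : normalizedTrace (1 : H →L[ℂ] H) = 1 := by
      have h1 := eq_normalizedTrace_smul_one (IsSelfAdjoint.one (H →L[ℂ] H)) ⟨1, by simp⟩
      have h2 : (1 : ℂ) = (normalizedTrace (1 : H →L[ℂ] H) : ℂ) :=
        smul_left_injective ℂ (one_ne_zero (α := H →L[ℂ] H)) (by simpa using h1)
      exact_mod_cast h2.symm
    have hLA := hLsmul _ 1 A hA1
    rw [hA, hL] at hLA
    have ht' : (φ 1 : H →L[ℂ] H) + ((t * normalizedTrace ((1 : selfAdjoint (H →L[ℂ] H)) :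
        H →L[ℂ] H) : ℝ) : ℂ) • 1 ≠ 0 := by
      rw [selfAdjoint.val_one, h1, mul_one]; exact ht
    have h0 := (smul_eq_zero.mp hLA.symm).resolve_right ht'
    refine Subtype.ext ?_
    rw [hA1, h0, zero_smul]
    rfl
  let θ : (H →L[ℂ] H) ≃ₗ[ℂ] (H →L[ℂ] H) :=
    LinearEquiv.ofInjectiveEndo (complexify L hLsmul) (complexify_injective L hLsmul hLinj)
  have hθ : ∀ X, θ X = complexify L hLsmul X := fun _ => rfl
  refine ⟨θ, fun A => ⟨-((t * normalizedTrace (A : H →L[ℂ] H) : ℝ) : ℂ), ?_⟩,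
    complexify_star L hLsmul, fun A X hA => ?_, fun A B hA hB => ?_⟩
  · rw [hθ, complexify_coe, hL, neg_smul, add_neg_cancel_right]
  · have hAL : θ A = L ⟨A, hA⟩ := complexify_coe L hLsmul ⟨A, hA⟩
    rw [hAL, commute_iff_commute_realPart_imaginaryPart hA,
      commute_iff_commute_realPart_imaginaryPart (L ⟨A, hA⟩).2, hθ, realPart_complexify,
      imaginaryPart_complexify, ← hLcomm, ← hLcomm]
  · rw [← hLlie ⟨A, hA⟩ ⟨B, hB⟩]
    exact congrArg N (congrArg₂ _ (complexify_coe L hLsmul ⟨A, hA⟩)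
      (complexify_coe L hLsmul ⟨B, hB⟩))

end Main

/-! ### The functional, the sign and the final form. -/

section Conclusion

variable {H : Type*} [NormedAddCommGroup H] [InnerProductSpace ℂ H]

lemma lie_rankOne_ne_zero {e f : H} (he : ‖e‖ = 1) (hf : ‖f‖ = 1) (hef : inner ℂ e f = 0) :
    ⁅rankOne ℂ e e, rankOne ℂ e f + rankOne ℂ f e⁆ ≠ 0 := by
  intro h
  have h' := DFunLike.congr_fun h f
  rw [Ring.lie_def] at h'
  change rankOne ℂ e e (rankOne ℂ e f f + rankOne ℂ f e f) -
    (rankOne ℂ e f (rankOne ℂ e e f) + rankOne ℂ f e (rankOne ℂ e e f)) = 0 at h'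
  simp [hef, he, hf] at h'
  rw [h'] at he
  simp at he

variable [CompleteSpace H]

lemma isSelfAdjoint_rankOne_add_rankOne (e f : H) :
    IsSelfAdjoint (rankOne ℂ e f + rankOne ℂ f e) := by
  rw [ContinuousLinearMap.isSelfAdjoint_iff', map_add, adjoint_rankOne, adjoint_rankOne, add_comm]

variable [FiniteDimensional ℂ H]

/-- Reading the scalar off as the normalized trace of the difference makes it real and linear in
`A`, with no choices involved. -/
lemma exists_functional_of_sub_eq_smul_one
    (φ : selfAdjoint (H →L[ℂ] H) →ₗ[ℝ] selfAdjoint (H →L[ℂ] H))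
    (ψ : (H →L[ℂ] H) →ₗ[ℂ] (H →L[ℂ] H)) (hψ : ∀ A, IsSelfAdjoint A → IsSelfAdjoint (ψ A))
    (h : ∀ A : selfAdjoint (H →L[ℂ] H), ∃ z : ℂ, (φ A : H →L[ℂ] H) = ψ A + z • 1) :
    ∃ f : selfAdjoint (H →L[ℂ] H) →ₗ[ℝ] ℝ,
      ∀ A, (φ A : H →L[ℂ] H) = ψ A + (f A : ℂ) • 1 := by
  have hadd : ∀ A B : selfAdjoint (H →L[ℂ] H),
      normalizedTrace ((φ (A + B) : H →L[ℂ] H) - ψ (A + B)) =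
        normalizedTrace ((φ A : H →L[ℂ] H) - ψ A) + normalizedTrace ((φ B : H →L[ℂ] H) - ψ B) := by
    intro A B
    rw [← normalizedTrace_add, map_add, AddSubgroup.coe_add, map_add, add_sub_add_comm]
  have hsmul : ∀ (r : ℝ) (A : selfAdjoint (H →L[ℂ] H)),
      normalizedTrace ((φ (r • A) : H →L[ℂ] H) - ψ ((r • A : selfAdjoint (H →L[ℂ] H)) :
        H →L[ℂ] H)) = r * normalizedTrace ((φ A : H →L[ℂ] H) - ψ A) := by
    intro r A
    have hr : ((r • A : selfAdjoint (H →L[ℂ] H)) : H →L[ℂ] H) = (r : ℂ) • (A : H →L[ℂ] H) := by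
      ext x; simp
    rw [coe_map_eq_smul φ r A (r • A) hr, hr, ψ.map_smul, ← normalizedTrace_smul, smul_sub]
  refine ⟨⟨⟨fun A => normalizedTrace ((φ A : H →L[ℂ] H) - ψ A), hadd⟩, hsmul⟩, fun A => ?_⟩
  obtain ⟨z, hz⟩ := h A
  have hs : IsSelfAdjoint ((φ A : H →L[ℂ] H) - ψ A) := IsSelfAdjoint.sub (φ A).2 (hψ A A.2)
  exact eq_add_of_sub_eq' (eq_normalizedTrace_smul_one hs ⟨z, by rw [hz, add_sub_cancel_left]⟩)

end Conclusion

theorem theorem1 {H : Type*} [NormedAddCommGroup H] [InnerProductSpace ℂ H] [CompleteSpace H]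
    [FiniteDimensional ℂ H]
    (N : Seminorm ℂ (H →L[ℂ] H)) (hN : IsUnitarilyInvariantNorm N)
    (φ : selfAdjoint (H →L[ℂ] H) →ₗ[ℝ] selfAdjoint (H →L[ℂ] H))
    (hφ : ∀ A B : selfAdjoint (H →L[ℂ] H),
      N ⁅(φ A : H →L[ℂ] H), (φ B : H →L[ℂ] H)⁆ = N ⁅(A : H →L[ℂ] H), (B : H →L[ℂ] H)⁆) :
    ∃ f : selfAdjoint (H →L[ℂ] H) →ₗ[ℝ] ℝ,
      (∃ U ∈ unitary (H →L[ℂ] H),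
        (∀ A, (φ A : H →L[ℂ] H) = U * (A : H →L[ℂ] H) * star U + (f A : ℂ) • 1) ∨
        (∀ A, (φ A : H →L[ℂ] H) = -(U * (A : H →L[ℂ] H) * star U) + (f A : ℂ) • 1)) ∨
      (∃ U : Antiunitary H,
        (∀ A, (φ A : H →L[ℂ] H) = U.conj (A : H →L[ℂ] H) + (f A : ℂ) • 1) ∨
        (∀ A, (φ A : H →L[ℂ] H) = -U.conj (A : H →L[ℂ] H) + (f A : ℂ) • 1)) := by
  rcases Nat.lt_or_ge (finrank ℂ H) 2 with hn | hn
  -- In dimension at most one every operator is scalar, so the identity serves as `U`.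
  · have hscal : ∀ A : H →L[ℂ] H, ∃ z : ℂ, A = z • 1 := by
      intro A
      obtain ⟨v, hv⟩ := finrank_le_one_iff.mp (Nat.lt_succ_iff.mp hn)
      obtain ⟨z, hz⟩ := hv (A v)
      refine ⟨z, ContinuousLinearMap.ext fun x => ?_⟩
      obtain ⟨y, rfl⟩ := hv x
      rw [map_smul, ← hz, smul_apply, one_apply_eq_self, smul_comm]
    obtain ⟨f, hf⟩ := exists_functional_of_sub_eq_smul_one φ LinearMap.id (fun A hA => hA)
      (fun A => by
        obtain ⟨z, hz⟩ := hscal (φ A - A)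
        exact ⟨z, eq_add_of_sub_eq' hz⟩)
    exact ⟨f, Or.inl ⟨1, one_mem _, Or.inl fun A => by simpa using hf A⟩⟩
  have : Nontrivial H := nontrivial_of_finrank_pos (R := ℂ) (by omega)
  obtain ⟨θ, hθφ, hstar, hcomm, hlie⟩ := exists_linearEquiv_of_lie hN φ hφ
  obtain ⟨c, ψ, hψ, hbij, hψs, hsq⟩ := exists_jordan_of_two_le hn hN hstar hcomm hlie
  have hφψ : ∀ A : selfAdjoint (H →L[ℂ] H),
      ∃ z : ℂ, (φ A : H →L[ℂ] H) = ((c : ℂ) • ψ) A + z • 1 := by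
    intro A
    obtain ⟨z, hz⟩ := hθφ A
    obtain ⟨w, hw⟩ := hψ A
    exact ⟨w + z, by rw [hz, hw, LinearMap.smul_apply, add_smul, add_assoc]⟩
  have hsa : ∀ A, IsSelfAdjoint A → IsSelfAdjoint (((c : ℂ) • ψ) A) := fun A hA => by
    rw [IsSelfAdjoint, LinearMap.smul_apply, star_smul, ← hψs, hA.star_eq, Complex.star_def,
      Complex.conj_ofReal]
  obtain ⟨f, hf⟩ := exists_functional_of_sub_eq_smul_one φ _ hsa hφψ
  let b := stdOrthonormalBasis ℂ H
  set e : H := b ⟨0, by omega⟩ with he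
  set g : H := b ⟨1, by omega⟩ with hg
  have hne : ⁅rankOne ℂ e e, rankOne ℂ e g + rankOne ℂ g e⁆ ≠ 0 :=
    lie_rankOne_ne_zero (b.norm_eq_one _) (b.norm_eq_one _) (b.inner_eq_zero (by simp))
  have hP := isSelfAdjoint_rankOne e
  have hQ := isSelfAdjoint_rankOne_add_rankOne e g
  have hc : N ⁅ψ (rankOne ℂ e e), ψ (rankOne ℂ e g + rankOne ℂ g e)⁆ =
      N ⁅rankOne ℂ e e, rankOne ℂ e g + rankOne ℂ g e⁆ → c = 1 ∨ c = -1 := by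
    obtain ⟨z, hz⟩ := hψ (rankOne ℂ e e)
    obtain ⟨w, hw⟩ := hψ (rankOne ℂ e g + rankOne ℂ g e)
    exact eq_one_or_eq_neg_one_of_lie hN hz hw (hlie _ _ hP hQ) hne
  have hlieU : ∀ U ∈ unitary (H →L[ℂ] H), ∀ A B : H →L[ℂ] H,
      N ⁅U * A * star U, U * B * star U⁆ = N ⁅A, B⁆ := by
    intro U hU A B
    have hUU := Unitary.star_mul_self_of_mem hU
    have hm : ∀ A B : H →L[ℂ] H, (U * A * star U) * (U * B * star U) = U * (A * B) * star U := by
      intro A B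
      calc (U * A * star U) * (U * B * star U) = U * A * (star U * U) * B * star U := by
            noncomm_ring
        _ = _ := by rw [hUU]; noncomm_ring
    rw [Ring.lie_def, hm, hm, ← sub_mul, ← mul_sub,
      hN.unitary_mul_mul U hU _ (Unitary.star_mem hU), Ring.lie_def]
  refine ⟨f, ?_⟩
  rcases map_mul_or_map_mul_rev_of_map_sq ψ
    ContinuousLinearMap.eq_zero_or_eq_zero_of_forall_mul_mul_eq_zero hsq hbij.2 with hmul | hmul
  · left
    obtain ⟨U, hU⟩ := exists_linearIsometryEquiv_of_map_mul ψ hbij hψs hmul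
    obtain ⟨V, hVm, hV⟩ := mul_linearIsometryEquiv_mul_star U
    have hψV : ∀ A, ψ A = V * A * star V := fun A =>
      ContinuousLinearMap.ext fun x => by rw [hU, hV]
    refine ⟨V, hVm, ?_⟩
    rcases hc (by rw [hψV, hψV, hlieU V hVm]) with rfl | rfl
    · left
      intro A
      rw [hf, LinearMap.smul_apply, hψV, Complex.ofReal_one, one_smul]
    · right
      intro A
      rw [hf, LinearMap.smul_apply, hψV, Complex.ofReal_neg, Complex.ofReal_one, neg_one_smul]
  · right
    obtain ⟨J, hJ, hJb, hJi⟩ := exists_antiunitary_involution b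
    obtain ⟨U, hU⟩ := exists_antiunitary_of_map_mul_rev ψ hbij hψs hmul hJ hJi
    obtain ⟨V, hVm, hV⟩ := mul_linearIsometryEquiv_mul_star U
    let W : Antiunitary H := J.trans U
    have hψW : ∀ A, IsSelfAdjoint A → ψ A = W.conj A := fun A hA =>
      ContinuousLinearMap.ext fun x => by
        rw [hU A hA, Antiunitary.conj_apply]
        have hs : W.symm x = J (U.symm x) := W.symm_apply_eq.mpr (by
          change x = U (J (J (U.symm x)))
          rw [hJ, U.apply_symm_apply])
        rw [hs]
        rfl
    -- Operators fixed by `J`, those with real matrices in `b`, are transformed by `ψ` as by a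
    -- unitary. The test pair is of this kind, so unitary invariance of `N` determines `c` without
    -- any invariance of `N` under transposition.
    have hfix : ∀ A, IsSelfAdjoint A → (∀ x, J (A (J x)) = A x) → ψ A = V * A * star V :=
      fun A hA h => ContinuousLinearMap.ext fun x => by rw [hU A hA, hV, h]
    have hJe : J e = e := hJb _
    have hJg : J g = g := hJb _
    have hJr : ∀ u v : H, J u = u → J v = v → ∀ x, J (rankOne ℂ u v (J x)) = rankOne ℂ u v x := by
      intro u v hu hv x
      rw [rankOne_apply, rankOne_apply, map_smulₛₗ, hu]
      congr 1
      conv_lhs => rw [← hv, hJi, inner_conj_symm]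
    refine ⟨W, ?_⟩
    rcases hc (by
      rw [hfix _ hP (hJr e e hJe hJe), hfix _ hQ (fun x => by
        rw [add_apply, add_apply, map_add, hJr e g hJe hJg, hJr g e hJg hJe]), hlieU V hVm])
      with rfl | rfl
    · left
      intro A
      rw [hf, LinearMap.smul_apply, hψW A A.2, Complex.ofReal_one, one_smul]
    · right
      intro A
      rw [hf, LinearMap.smul_apply, hψW A A.2, Complex.ofReal_neg, Complex.ofReal_one,
        neg_one_smul]
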